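/- **Proposition (IMG of a formal mating).** Let $d\ge 2$ and let $f_1,f_2:\mathbb{C}\to\mathbb{C}$ be two monic polynomials of degree $d$ that are post-critically finite, i.e. whose post-critical sets $P_{f_i}=\{f_i^n(c): n\ge 1,\ c \text{ a critical point of } f_i\}\subset\mathbb{C}$ are finite. Let $\widetilde{\mathbb{C}}_i=\mathbb{C}\cup\{\infty\cdot e^{2i\pi\theta}:\theta\in\mathbb{R}/\mathbb{Z}\}$ be two copies of the plane compactified by a circle at infinity (so that $\widetilde{\mathbb{C}}_i$ is a closed disk), with $f_i$ extended by $\infty\cdot e^{2i\pi\theta}\mapsto\infty\cdot e^{2i\pi d\theta}$, and let $S$ be the topological sphere obtained from $\widetilde{\mathbb{C}}_1\sqcup\widetilde{\mathbb{C}}_2$ by identifying $\infty\cdot e^{2i\pi\theta}\in\widetilde{\mathbb{C}}_1$ with $\infty\cdot e^{-2i\pi\theta}\in\widetilde{\mathbb{C}}_2$. Let $F=f_1\sqcup\!\sqcup f_2:S\to S$, the formal mating, be the map induced by the two extended maps, and let $P_F$ be its post-critical set (the critical points of $F$ being the points at which $F$ is not locally injective). For a map $f:X\to X$ with post-critical set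 $P_f$ which restricts to a covering $f:X\setminus f^{-1}(P_f)\to X\setminus P_f$ of degree $d$, where $X\setminus P_f$ is path connected and locally path connected, and for $t\in X\setminus P_f$, let $\mathrm{IMG}(f,t)=\pi_1(X\setminus P_f,t)/\mathrm{Ker}(\Phi)$, where $\Phi$ is the monodromy action of $\pi_1(X\setminus P_f,t)$ on $\bigsqcup_{n\ge 0}f^{-n}(t)$: the class of a loop $\gamma$ sends $x\in f^{-n}(t)$ to the terminal point of the lift of $\gamma$ by $f^n$ from $x$. Then $F$ is post-critically finite; the maps $f_1$, $f_2$ and $F$ restrict to such coverings of degree $d$ of $\mathbb{C}\setminus P_{f_1}$, $\mathbb{C}\setminus P_{f_2}$ and $S\setminus P_F$ respectively; and for all base points $t_1\in\mathbb{C}\setminus P_{f_1}$, $t_2\in\mathbb{C}\setminus P_{f_2}$ and $t\in S\setminus P_F$ there are subgroups $H_1,H_2$ of $\mathrm{IMG}(F,t)$ which together generate $\mathrm{IMG}(F,t)$ and satisfy $H_1\cong\mathrm{IMG}(f_1,t_1)$ and $H_2\cong\mathrm{IMG}(f_2,t_2)$. -/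

import Mathlib

open Topology

/-! ### Partial self-coverings and their iterates -/

/-- The map `f : X → X` induces a partial self-covering `f : f ⁻¹(M) → M` of degree `d ≥ 2` of the
path connected and locally path connected subspace `M`, with `f ⁻¹(M) ⊆ M`. -/
structure IsPartialSelfCovering {X : Type*} [TopologicalSpace X] (f : X → X) (M : Set X) (d : ℕ) :
    Prop where
  isPathConnected : IsPathConnected M
  locallyPathConnected : LocallyPathConnectedSpace M
  preimage_subset : f ⁻¹' M ⊆ M
  isCoveringMap : IsCoveringMap (M.restrictPreimage f)
  two_le_degree : 2 ≤ d
  degree_eq : ∀ y ∈ M, (f ⁻¹' {y}).ncard = d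

/-- Around every point a covering map has a neighbourhood whose preimage splits into open sheets. -/
theorem IsCoveringMap.exists_sheets {E X : Type*} [TopologicalSpace E] [TopologicalSpace X]
    {q : E → X} (hq : IsCoveringMap q) (x : X) :
    ∃ (V : Set X) (S : q ⁻¹' {x} → Set E), IsOpen V ∧ x ∈ V ∧ (∀ e, IsOpen (S e)) ∧
      (∀ e, (e : E) ∈ S e) ∧ (∀ e, (S e).InjOn q) ∧ (∀ e, (S e).SurjOn q V) ∧
      Pairwise (Function.onFun Disjoint S) ∧ q ⁻¹' V ⊆ ⋃ e, S e := by
  obtain ⟨hd, U, hxU, hU, hqU, H, hH⟩ := hq x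
  have hHs : ∀ y : U × (q ⁻¹' {x}), q (H.symm y) = y.1 := fun y => by
    rw [← hH, H.apply_symm_apply]
  have hmem : ∀ e : q ⁻¹' {x}, q e ∈ U := fun e => by
    have : q e = x := e.2
    rwa [this]
  -- the sheet through `e`
  refine ⟨U, fun e => Subtype.val '' (H ⁻¹' {y | y.2 = (H ⟨e, hmem e⟩).2}), hU, hxU, ?_, ?_, ?_,
    ?_, ?_, ?_⟩
  · intro e
    refine hqU.isOpenMap_subtype_val _ (IsOpen.preimage H.continuous ?_)
    exact (isOpen_discrete {(H ⟨e, hmem e⟩).2}).preimage continuous_snd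
  · intro e
    exact ⟨⟨e, hmem e⟩, rfl, rfl⟩
  · rintro e _ ⟨a, ha, rfl⟩ _ ⟨b, hb, rfl⟩ hab
    have : H a = H b := Prod.ext (Subtype.ext (by rw [hH, hH]; exact hab)) (ha.trans hb.symm)
    rw [H.injective this]
  · intro e u hu
    exact ⟨H.symm (⟨u, hu⟩, (H ⟨e, hmem e⟩).2), ⟨_, by simp, rfl⟩, hHs _⟩
  · intro e e' hne
    refine Set.disjoint_left.mpr ?_
    rintro _ ⟨a, ha, rfl⟩ ⟨b, hb, hab⟩
    obtain rfl : b = a := Subtype.ext hab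
    apply hne
    have h2 : (H ⟨e, hmem e⟩).2 = (H ⟨e', hmem e'⟩).2 := ha.symm.trans hb
    have : H ⟨e, hmem e⟩ = H ⟨e', hmem e'⟩ := by
      refine Prod.ext (Subtype.ext ?_) h2
      rw [hH, hH]
      exact (show q e = x from e.2).trans (show q e' = x from e'.2).symm
    exact Subtype.ext (congrArg (fun a : q ⁻¹' U => (a : E)) (H.injective this))
  · intro e he
    have hx : q (H.symm (⟨x, hxU⟩, (H ⟨e, he⟩).2)) = x := hHs _
    refine Set.mem_iUnion.mpr ⟨⟨H.symm (⟨x, hxU⟩, (H ⟨e, he⟩).2), hx⟩, ⟨e, he⟩, ?_, rfl⟩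
    simp

/-- The composition of two surjective covering maps is a covering map if the second one has finite
fibers. -/
theorem IsCoveringMap.comp_of_finite {D E X : Type*} [TopologicalSpace D] [TopologicalSpace E]
    [TopologicalSpace X] {q : E → X} {r : D → E} (hq : IsCoveringMap q) (hr : IsCoveringMap r)
    (hqs : Function.Surjective q) (hrs : Function.Surjective r)
    (hfin : ∀ x, (q ⁻¹' {x}).Finite) : IsCoveringMap (q ∘ r) := by
  intro x
  obtain ⟨V, S, hV, hxV, hSo, hSm, hSi, hSs, hSd, hSe⟩ := hq.exists_sheets x
  choose W T hW hxW hTo hTm hTi hTs hTd hTe using fun e : q ⁻¹' {x} => hr.exists_sheets e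
  have : Finite (q ⁻¹' {x}) := hfin x
  set O : Set X := V ∩ ⋂ e, q '' (S e ∩ W e) with hO
  have hOo : IsOpen O :=
    hV.inter (isOpen_iInter_of_finite fun e => hq.isOpenMap _ ((hSo e).inter (hW e)))
  have hxO : x ∈ O := ⟨hxV, Set.mem_iInter.mpr fun e => ⟨e, ⟨hSm e, hxW e⟩, e.2⟩⟩
  have hcont : Continuous (q ∘ r) := hq.continuous.comp hr.continuous
  have hopen : IsOpenMap (q ∘ r) := hq.isOpenMap.comp hr.isOpenMap
  let ι := Σ e : q ⁻¹' {x}, r ⁻¹' {(e : E)}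
  let _ : TopologicalSpace ι := ⊥
  have : DiscreteTopology ι := ⟨rfl⟩
  obtain ⟨e₀, he₀⟩ := hqs x
  obtain ⟨d₀, hd₀⟩ := hrs e₀
  have : Nonempty ι := ⟨⟨⟨e₀, he₀⟩, ⟨d₀, hd₀⟩⟩⟩
  have : Nonempty (X → D) := ⟨fun _ => d₀⟩
  let U : ι → Set D := fun i => (r ⁻¹' S i.1) ∩ T i.1 i.2
  have hUo : ∀ i, IsOpen (U i) := fun i => ((hSo _).preimage hr.continuous).inter (hTo _ _)
  have hUs : ∀ i, (U i).SurjOn (q ∘ r) O := by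
    intro i w hw
    obtain ⟨y, ⟨hyS, hyW⟩, rfl⟩ := Set.mem_iInter.mp hw.2 i.1
    obtain ⟨z, hz, rfl⟩ := hTs i.1 i.2 hyW
    exact ⟨z, ⟨hyS, hz⟩, rfl⟩
  refine (IsEvenlyCovered.of_trivialization (I := ι)
    (t := IsOpen.trivializationDiscrete (f := q ∘ r) U O hOo ?_ ?_ hUs ?_ ?_)
    hxO).to_isEvenlyCovered_preimage
  · intro i A hA
    refine ⟨fun h => (h.preimage hcont).inter (hUo i), fun h => ?_⟩
    convert hopen _ h using 1
    ext w
    constructor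
    · intro hw
      obtain ⟨z, hz, rfl⟩ := hUs i (hA hw)
      exact ⟨z, ⟨hw, hz⟩, rfl⟩
    · rintro ⟨z, ⟨hz, -⟩, rfl⟩
      exact hz
  · intro i a ha b hb hab
    exact hTi i.1 i.2 ha.2 hb.2 (hSi i.1 ha.1 hb.1 hab)
  · rintro ⟨e, z⟩ ⟨e', z'⟩ hne
    by_cases h : e = e'
    · subst h
      have hz : z ≠ z' := fun h => hne (by rw [h])
      exact (hTd e hz).mono Set.inter_subset_right Set.inter_subset_right
    · exact ((hSd h).preimage r).mono Set.inter_subset_left Set.inter_subset_left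
  · intro z hz
    obtain ⟨e, he⟩ := Set.mem_iUnion.mp (hSe (show r z ∈ q ⁻¹' V from hz.1))
    obtain ⟨y, ⟨hyS, hyW⟩, hy⟩ := Set.mem_iInter.mp hz.2 e
    have hyr : y = r z := hSi e hyS he hy
    obtain ⟨j, hj⟩ := Set.mem_iUnion.mp (hTe e (show r z ∈ W e from hyr ▸ hyW))
    exact Set.mem_iUnion.mpr ⟨⟨e, j⟩, he, hj⟩

theorem isCoveringMap_id (X : Type*) [TopologicalSpace X] : IsCoveringMap (id : X → X) := by
  intro x
  let H : (id ⁻¹' (Set.univ : Set X)) ≃ₜ ↥(Set.univ : Set X) × Unit :=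
    { toFun := fun e => (⟨e.1, trivial⟩, ())
      invFun := fun e => ⟨e.1.1, trivial⟩
      left_inv := fun _ => rfl
      right_inv := fun _ => rfl }
  exact IsEvenlyCovered.to_isEvenlyCovered_preimage (I := Unit)
    ⟨inferInstance, Set.univ, trivial, isOpen_univ, isOpen_univ, H, fun _ => rfl⟩

/-- A covering map `f ⁻¹(M) → M` restricts to a covering map `f ⁻¹(T) → T` for `T ⊆ M`. -/
theorem IsCoveringMap.restrictPreimage_of_subset {X : Type*} [TopologicalSpace X] {f : X → X}
    {M T : Set X} (h : IsCoveringMap (M.restrictPreimage f)) (hT : T ⊆ M) :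
    IsCoveringMap (T.restrictPreimage f) := by
  have h1 := h.restrictPreimage ((↑) ⁻¹' T : Set M)
  let g : ((↑) ⁻¹' T : Set M) ≃ₜ T :=
    { toFun := fun x => ⟨x.1.1, x.2⟩
      invFun := fun x => ⟨⟨x.1, hT x.2⟩, x.2⟩
      left_inv := fun _ => rfl
      right_inv := fun _ => rfl }
  let k : (f ⁻¹' T) ≃ₜ (M.restrictPreimage f ⁻¹' ((↑) ⁻¹' T : Set M)) :=
    { toFun := fun x => ⟨⟨x.1, hT x.2⟩, x.2⟩
      invFun := fun x => ⟨x.1.1, x.2⟩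
      left_inv := fun _ => rfl
      right_inv := fun _ => rfl }
  exact (h1.comp_homeomorph k).homeomorph_comp g

namespace IsPartialSelfCovering

variable {X : Type*} [TopologicalSpace X] {f : X → X} {M : Set X} {d : ℕ}

theorem finite_fiber (h : IsPartialSelfCovering f M d) {y : X} (hy : y ∈ M) :
    (f ⁻¹' {y}).Finite := by
  refine Set.finite_of_ncard_ne_zero ?_
  rw [h.degree_eq y hy]
  have := h.two_le_degree
  omega

theorem exists_preimage (h : IsPartialSelfCovering f M d) {y : X} (hy : y ∈ M) :
    ∃ x, f x = y := by
  have h2 : (f ⁻¹' {y}).ncard ≠ 0 := by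
    rw [h.degree_eq y hy]
    have := h.two_le_degree
    omega
  exact Set.nonempty_of_ncard_ne_zero h2

theorem iterate_preimage_subset (h : IsPartialSelfCovering f M d) (n : ℕ) : f^[n] ⁻¹' M ⊆ M := by
  induction n with
  | zero => exact subset_rfl
  | succ n ih => exact fun x hx => h.preimage_subset (ih hx)

theorem iterate_aux (h : IsPartialSelfCovering f M d) (n : ℕ) :
    IsCoveringMap (M.restrictPreimage f^[n]) ∧ Function.Surjective (M.restrictPreimage f^[n]) ∧
      ∀ x, ((M.restrictPreimage f^[n]) ⁻¹' {x}).Finite := by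
  induction n with
  | zero =>
    refine ⟨isCoveringMap_id M, fun x => ⟨x, rfl⟩, fun x => ?_⟩
    exact (Set.finite_singleton x).subset fun y hy => hy
  | succ n ih =>
    obtain ⟨hc, hs, hf⟩ := ih
    have hr := h.isCoveringMap.restrictPreimage_of_subset (h.iterate_preimage_subset n)
    have hrs : Function.Surjective ((f^[n] ⁻¹' M).restrictPreimage f) := by
      intro y
      obtain ⟨x, hx⟩ := h.exists_preimage (h.iterate_preimage_subset n y.2)
      exact ⟨⟨x, by rw [Set.mem_preimage, hx]; exact y.2⟩, Subtype.ext hx⟩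
    refine ⟨hc.comp_of_finite hr hs hrs hf, hs.comp hrs, fun x => ?_⟩
    refine Set.Finite.preimage' (f := (f^[n] ⁻¹' M).restrictPreimage f) (hf x) fun y _ => ?_
    refine Set.Finite.of_finite_image (f := Subtype.val) ?_ Subtype.val_injective.injOn
    refine (h.finite_fiber (h.iterate_preimage_subset n y.2)).subset ?_
    rintro _ ⟨z, hz, rfl⟩
    exact congrArg Subtype.val hz

/-- The `n`-th iterate `f^n : f ^{-n}(M) → M` of a partial self-covering is a covering map. -/
theorem iterate (h : IsPartialSelfCovering f M d) (n : ℕ) :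
    IsCoveringMap (M.restrictPreimage f^[n]) :=
  (h.iterate_aux n).1

/-! ### The monodromy action and the iterated monodromy group -/

/-- The vertices of the tree of preimages: the disjoint union over `n` of the fibers over `t` of
the iterates `f^n : f ^{-n}(M) → M`. -/
abbrev TreeVertex (f : X → X) (M : Set X) (t : M) : Type _ :=
  Σ n : ℕ, (M.restrictPreimage f^[n]) ⁻¹' {t}

/-- The monodromy action of `π₁(M, t)` on the tree of preimages: on level `n`, the class of a
loop `γ` sends `x` to the terminal point of the `f^n`-lift of `γ` from `x`. -/
noncomputable def monodromyAction (h : IsPartialSelfCovering f M d) (t : M) :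
    FundamentalGroup M t →* Equiv.Perm (TreeVertex f M t) :=
  (Equiv.Perm.sigmaCongrRightHom fun n : ℕ => (M.restrictPreimage f^[n]) ⁻¹' {t}).comp
    (MonoidHom.pi fun n => (h.iterate n).monodromyPerm t)

/-- The iterated monodromy group with base point `t`: the quotient of `π₁(M, t)` by the kernel of
the monodromy action. -/
abbrev IMG (h : IsPartialSelfCovering f M d) (t : M) : Type _ :=
  FundamentalGroup M t ⧸ (h.monodromyAction t).ker

end IsPartialSelfCovering

/-! ### Post-critical sets -/

/-- The critical points of a (branched covering) map: the points where it is not locally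
injective. For a non-constant polynomial map of `ℂ`, they are the zeros of the derivative. -/
def criticalSet {X : Type*} [TopologicalSpace X] (f : X → X) : Set X :=
  {x | ¬ ∃ U ∈ 𝓝 x, Set.InjOn f U}

/-- The post-critical set `P_f`: the points `f^n(c)` with `n ≥ 1` and `c` a critical point. -/
def postcriticalSet {X : Type*} [TopologicalSpace X] (f : X → X) : Set X :=
  ⋃ n : ℕ, f^[n + 1] '' criticalSet f

def IsPostcriticallyFinite {X : Type*} [TopologicalSpace X] (f : X → X) : Prop :=
  (postcriticalSet f).Finite

/-! ### Formal matings -/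

/-- The complex plane compactified by a circle at infinity. -/
inductive ClosedPlane : Type
  | point (z : ℂ) : ClosedPlane
  | infinity (ζ : Circle) : ClosedPlane

namespace ClosedPlane

/-- The bijection onto the closed unit disk that is used to define the topology. -/
noncomputable def toDisk : ClosedPlane → ℂ
  | point z => z / (1 + ‖z‖ : ℝ)
  | infinity ζ => (ζ : ℂ)

noncomputable instance : TopologicalSpace ClosedPlane :=
  TopologicalSpace.induced toDisk inferInstance

/-- The extension of a map of the plane by `∞ · ζ ↦ ∞ · ζ ^ d` on the circle at infinity. -/
noncomputable def extend (d : ℕ) (f : ℂ → ℂ) : ClosedPlane → ClosedPlane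
  | point z => point (f z)
  | infinity ζ => infinity (ζ ^ d)

end ClosedPlane

/-- The gluing of the circles at infinity in the opposite direction:
`∞ · ζ` in the first copy is identified with `∞ · ζ⁻¹` in the second copy. -/
inductive MatingRel : ClosedPlane ⊕ ClosedPlane → ClosedPlane ⊕ ClosedPlane → Prop
  | glue (ζ : Circle) : MatingRel (.inl (.infinity ζ)) (.inr (.infinity ζ⁻¹))

/-- The topological sphere obtained by gluing two closed planes along their circles at infinity,
with the quotient topology. -/
def MatingSphere : Type := Quot MatingRel

instance : TopologicalSpace MatingSphere :=
  inferInstanceAs (TopologicalSpace (Quot MatingRel))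

/-- The formal mating of two maps of the plane of degree `d`: it acts as `f₁` on the first
hemisphere, as `f₂` on the second one, and as `ζ ↦ ζ ^ d` on the common circle at infinity. -/
noncomputable def formalMating (d : ℕ) (f₁ f₂ : ℂ → ℂ) : MatingSphere → MatingSphere :=
  Quot.map (Sum.map (ClosedPlane.extend d f₁) (ClosedPlane.extend d f₂)) (by
    rintro _ _ ⟨ζ⟩
    have h := MatingRel.glue (ζ ^ d)
    rw [← inv_pow] at h
    exact h)

/-! The mating preserves each open hemisphere and the equator, and so do its preimages: on
hemisphere `i` it is `fᵢ`, on the equator it is `ζ ↦ ζ ^ d`. Near infinity a monic polynomial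
behaves like `z ^ d`, so the mating is locally injective along the equator (`exists_injOn_extend`,
`infinity_notMem_criticalSet`). Hence its post-critical set is the union of the two given ones,
placed in the hemispheres (`postcriticalSet_formalMating`), and is finite. All three maps are
continuous, closed, locally injective off their critical sets, and have exactly `d` preimages over
each non-post-critical point; such maps restrict to coverings (`isCoveringMap_of_ncard_fiber_eq`).

The inclusion of a punctured hemisphere, together with a path between base points, gives a
homomorphism of its fundamental group into that of the punctured sphere. A lift of a loop under
`fᵢ^n` is carried to a lift under the iterated mating, and the whole fiber over a point of
hemisphere `i` stays in that hemisphere. Thus a loop acts trivially for `fᵢ` exactly when its image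
acts trivially for the mating (`IsPartialSelfCovering.mapAlong_mem_ker_iff`), and `IMG(fᵢ)` embeds
in the IMG of the mating.

For generation, each hemisphere is thickened across the equator to an open cap. The caps cover the
punctured sphere and meet in an annulus, so the surjectivity half of van Kampen's theorem
(`FundamentalGroup.subgroup_eq_top_of_isOpen_cover`) applies. Each cap is pushed radially back into
its hemisphere (`exists_homotopy_cap`), so the two homomorphisms have ranges generating the
fundamental group, and hence its quotient. -/

namespace ClosedPlane

/-! ### The closed plane as a closed disk -/

/-- A continuous retraction of `ℂ` onto the closed disk, read in the closed plane. -/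
noncomputable def ofDisk (x : ℂ) : ClosedPlane :=
  if ‖x‖ < 1 then point (x / (1 - ‖x‖ : ℝ)) else infinity (Circle.exp x.arg)

theorem toDisk_point (z : ℂ) : toDisk (point z) = z / (1 + ‖z‖ : ℝ) := rfl

@[simp] theorem toDisk_infinity (ζ : Circle) : toDisk (infinity ζ) = ζ := rfl

theorem norm_toDisk_point (z : ℂ) : ‖toDisk (point z)‖ = ‖z‖ / (1 + ‖z‖) := by
  rw [toDisk_point, norm_div, Complex.norm_real, Real.norm_of_nonneg (by positivity)]

theorem norm_toDisk_point_lt (z : ℂ) : ‖toDisk (point z)‖ < 1 := by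
  rw [norm_toDisk_point, div_lt_one (by positivity)]
  linarith

theorem one_sub_norm_toDisk_point (z : ℂ) : 1 - ‖toDisk (point z)‖ = (1 + ‖z‖)⁻¹ := by
  have : 1 + ‖z‖ ≠ 0 := by positivity
  rw [norm_toDisk_point]
  field_simp
  ring

theorem norm_toDisk_infinity (ζ : Circle) : ‖toDisk (infinity ζ)‖ = 1 := Circle.norm_coe ζ

theorem norm_toDisk_le (c : ClosedPlane) : ‖toDisk c‖ ≤ 1 := by
  cases c with
  | point z => exact (norm_toDisk_point_lt z).le
  | infinity ζ => exact (norm_toDisk_infinity ζ).le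

theorem ofDisk_toDisk (c : ClosedPlane) : ofDisk (toDisk c) = c := by
  cases c with
  | point z =>
    rw [ofDisk, if_pos (norm_toDisk_point_lt z), one_sub_norm_toDisk_point, toDisk_point]
    have : ((1 + ‖z‖ : ℝ) : ℂ) ≠ 0 := by exact_mod_cast (by positivity : 1 + ‖z‖ ≠ 0)
    congr 1
    push_cast at this ⊢
    field_simp
  | infinity ζ => simp [ofDisk, Circle.exp_arg, Circle.norm_coe]

theorem toDisk_ofDisk (x : ℂ) : toDisk (ofDisk x) = x / (max 1 ‖x‖ : ℝ) := by
  by_cases h : ‖x‖ < 1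
  · rw [ofDisk, if_pos h, toDisk_point, max_eq_left h.le]
    have h0 : 0 < 1 - ‖x‖ := by linarith
    have h1 : ((1 - ‖x‖ : ℝ) : ℂ) ≠ 0 := by exact_mod_cast h0.ne'
    rw [norm_div, Complex.norm_real, Real.norm_of_nonneg h0.le]
    have : 1 + ‖x‖ / (1 - ‖x‖) = (1 - ‖x‖)⁻¹ := by field_simp; ring
    rw [this]
    push_cast at h1 ⊢
    field_simp
  · rw [ofDisk, if_neg h, toDisk_infinity, max_eq_right (not_lt.mp h), Circle.coe_exp]
    have h0 : (‖x‖ : ℂ) ≠ 0 := by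
      exact_mod_cast (by linarith : (0 : ℝ) < ‖x‖).ne'
    rw [eq_div_iff h0, mul_comm, Complex.norm_mul_exp_arg_mul_I]

theorem toDisk_ofDisk_of_norm_le {x : ℂ} (h : ‖x‖ ≤ 1) : toDisk (ofDisk x) = x := by
  rw [toDisk_ofDisk, max_eq_left h]
  simp

theorem toDisk_injective : Function.Injective toDisk :=
  Function.LeftInverse.injective ofDisk_toDisk

theorem continuous_toDisk : Continuous toDisk := continuous_induced_dom

theorem isEmbedding_toDisk : IsEmbedding toDisk := ⟨⟨rfl⟩, toDisk_injective⟩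

/-- Despite the case split and the discontinuity of `arg`, in the disk coordinate this is the
retraction `x ↦ x / max 1 ‖x‖`. -/
theorem continuous_ofDisk : Continuous ofDisk := by
  refine isEmbedding_toDisk.continuous_iff.mpr ?_
  have : toDisk ∘ ofDisk = fun x : ℂ => x / ((max 1 ‖x‖ : ℝ) : ℂ) := funext toDisk_ofDisk
  rw [this]
  refine continuous_id.div (Complex.continuous_ofReal.comp (by fun_prop)) fun x => ?_
  exact_mod_cast (lt_of_lt_of_le one_pos (le_max_left 1 ‖x‖)).ne'

theorem ofDisk_eq_infinity (ζ : Circle) : ofDisk ζ = infinity ζ := ofDisk_toDisk (infinity ζ)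

theorem ofDisk_of_norm_lt {x : ℂ} (h : ‖x‖ < 1) : ofDisk x = point (x / (1 - ‖x‖ : ℝ)) :=
  if_pos h

/-- A retraction is a quotient map; this transfers local path connectedness from `ℂ`. -/
theorem isQuotientMap_ofDisk : IsQuotientMap ofDisk :=
  IsQuotientMap.of_comp continuous_toDisk continuous_ofDisk (by
    rw [show ofDisk ∘ toDisk = id from funext ofDisk_toDisk]
    exact IsQuotientMap.id)

instance : T2Space ClosedPlane := isEmbedding_toDisk.t2Space

instance : LocallyPathConnectedSpace ClosedPlane := isQuotientMap_ofDisk.locallyPathConnectedSpace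

instance : CompactSpace ClosedPlane := by
  refine ⟨?_⟩
  have : (Set.univ : Set ClosedPlane) = ofDisk '' Metric.closedBall 0 1 := by
    refine (Set.eq_univ_of_forall fun c => (⟨toDisk c, ?_, ofDisk_toDisk c⟩ : ∃ x, _)).symm
    simpa using norm_toDisk_le c
  rw [this]
  exact (isCompact_closedBall 0 1).image continuous_ofDisk

theorem point_injective : Function.Injective point := fun _ _ h => by injection h

theorem continuous_point : Continuous point := by
  refine isEmbedding_toDisk.continuous_iff.mpr ?_
  refine continuous_id.div (Complex.continuous_ofReal.comp (by fun_prop)) fun x => ?_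
  exact_mod_cast (by positivity : 1 + ‖x‖ ≠ 0)

theorem range_point : Set.range point = {c | ‖toDisk c‖ < 1} := by
  ext c
  constructor
  · rintro ⟨z, rfl⟩
    exact norm_toDisk_point_lt z
  · intro h
    cases c with
    | point z => exact ⟨z, rfl⟩
    | infinity ζ => exact absurd h (norm_toDisk_infinity ζ).not_lt

/-- The inverse of `point`, extended arbitrarily. -/
noncomputable def toPlane (c : ClosedPlane) : ℂ := toDisk c / (1 - ‖toDisk c‖ : ℝ)

theorem toPlane_point (z : ℂ) : toPlane (point z) = z := by
  have h := ofDisk_toDisk (point z)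
  rw [ofDisk_of_norm_lt (norm_toDisk_point_lt z)] at h
  exact point_injective h

theorem isOpenEmbedding_point : IsOpenEmbedding point := by
  refine .of_continuous_injective_isOpenMap continuous_point point_injective fun U hU => ?_
  have : point '' U = toPlane ⁻¹' U ∩ Set.range point := by
    ext c
    constructor
    · rintro ⟨z, hz, rfl⟩
      exact ⟨by rwa [Set.mem_preimage, toPlane_point], z, rfl⟩
    · rintro ⟨hz, z, rfl⟩
      exact ⟨z, by rwa [Set.mem_preimage, toPlane_point] at hz, rfl⟩
  have ho : IsOpen {c | ‖toDisk c‖ < 1} :=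
    isOpen_lt (continuous_toDisk.norm) continuous_const
  rw [this, range_point, Set.inter_comm]
  refine ContinuousOn.isOpen_inter_preimage ?_ ho hU
  refine ContinuousOn.div continuous_toDisk.continuousOn
    (Complex.continuous_ofReal.comp (continuous_const.sub continuous_toDisk.norm)).continuousOn
    fun c hc => ?_
  exact_mod_cast (sub_pos.mpr hc).ne'

end ClosedPlane

open ClosedPlane

/-! ### Topology of the mating sphere -/

namespace MatingSphere

/-- The two closed hemispheres of the mating sphere. -/
def side (i : Bool) (c : ClosedPlane) : MatingSphere := Quot.mk _ (cond i (.inr c) (.inl c))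

theorem side_infinity (i : Bool) (ζ : Circle) :
    side i (infinity ζ) = side (!i) (infinity ζ⁻¹) := by
  cases i with
  | false => exact Quot.sound (MatingRel.glue ζ)
  | true =>
    refine (Quot.sound ?_).symm
    have := MatingRel.glue ζ⁻¹
    rwa [inv_inv] at this

theorem exists_side (y : MatingSphere) : ∃ i c, side i c = y := by
  obtain ⟨c | c, rfl⟩ := Quot.exists_rep y
  exacts [⟨false, c, rfl⟩, ⟨true, c, rfl⟩]

theorem exists_hemisphere_or_infinity (y : MatingSphere) :
    (∃ i z, side i (point z) = y) ∨ ∃ ζ, side false (infinity ζ) = y := by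
  obtain ⟨i, z | ζ, rfl⟩ := exists_side y
  · exact .inl ⟨i, z, rfl⟩
  · cases i with
    | false => exact .inr ⟨ζ, rfl⟩
    | true => exact .inr ⟨ζ⁻¹, (side_infinity true ζ).symm⟩

theorem continuous_side (i : Bool) : Continuous (side i) := by
  cases i with
  | false => exact continuous_quot_mk.comp continuous_inl
  | true => exact continuous_quot_mk.comp continuous_inr

/-- Maps defined on the two hemispheres which agree on the equator. -/
def lift {Y : Type*} (g : Bool → ClosedPlane → Y)
    (h : ∀ ζ, g false (infinity ζ) = g true (infinity ζ⁻¹)) : MatingSphere → Y :=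
  Quot.lift (Sum.elim (g false) (g true)) (by rintro _ _ ⟨ζ⟩; exact h ζ)

theorem lift_side {Y : Type*} (g : Bool → ClosedPlane → Y)
    (h : ∀ ζ, g false (infinity ζ) = g true (infinity ζ⁻¹)) (i : Bool) (c : ClosedPlane) :
    lift g h (side i c) = g i c := by
  cases i <;> rfl

theorem continuous_iff {Y : Type*} [TopologicalSpace Y] {g : MatingSphere → Y} :
    Continuous g ↔ ∀ i, Continuous (g ∘ side i) := by
  refine ⟨fun h i => h.comp (continuous_side i), fun h => ?_⟩
  refine continuous_coinduced_dom.mpr (continuous_sum_dom.mpr ⟨h false, h true⟩)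

theorem isOpen_iff {U : Set MatingSphere} : IsOpen U ↔ ∀ i, IsOpen (side i ⁻¹' U) := by
  simpa [continuous_Prop, Function.comp_def] using! continuous_iff (g := fun y => y ∈ U)

/-- An embedding of the mating sphere as a double cone in `ℂ × ℝ`. -/
noncomputable def toCone : MatingSphere → ℂ × ℝ :=
  lift (fun i c => cond i ((starRingEnd ℂ) (toDisk c), ‖toDisk c‖ - 1)
    (toDisk c, 1 - ‖toDisk c‖)) (fun ζ => by
      simp [Circle.coe_inv_eq_conj, -Circle.coe_inv, Circle.norm_coe])

/-- The height is nonnegative on the first hemisphere and nonpositive on the second, and vanishes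
only on the equator. Points from different sides with equal images are therefore equatorial, and the
gluing relation moves them to one side, where the disk coordinate separates them. -/
theorem toCone_injective : Function.Injective toCone := by
  have key : ∀ i c c', toCone (side i c) = toCone (side i c') → side i c = side i c' := by
    intro i c c' h
    cases i with
    | false =>
      simp only [toCone, lift_side, cond_false, Prod.mk.injEq] at h
      rw [toDisk_injective h.1]
    | true =>
      simp only [toCone, lift_side, cond_true, Prod.mk.injEq] at h
      rw [toDisk_injective ((starRingEnd ℂ).injective h.1)]
  have key2 : ∀ c c', toCone (side false c) = toCone (side true c') →
      side false c = side true c' := by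
    intro c c' h
    have h2 : 1 - ‖toDisk c‖ = ‖toDisk c'‖ - 1 := by
      have := congrArg Prod.snd h
      simpa only [toCone, lift_side, cond_true, cond_false] using this
    have hc : c' ∉ Set.range point := by
      rw [range_point, Set.mem_ofPred_eq]
      linarith [norm_toDisk_le c]
    cases c' with
    | point z => exact absurd ⟨z, rfl⟩ hc
    | infinity ζ =>
      rw [side_infinity true ζ] at h ⊢
      exact key false _ _ h
  intro y y' h
  obtain ⟨i, c, rfl⟩ := exists_side y
  obtain ⟨k, c', rfl⟩ := exists_side y'
  rcases i with _ | _ <;> rcases k with _ | _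
  · exact key _ _ _ h
  · exact key2 _ _ h
  · exact (key2 _ _ h.symm).symm
  · exact key _ _ _ h

theorem continuous_toCone : Continuous toCone := by
  refine continuous_iff.mpr fun i => ?_
  have h := continuous_toDisk
  cases i with
  | false => exact h.prodMk (continuous_const.sub h.norm)
  | true => exact (Complex.continuous_conj.comp h).prodMk (h.norm.sub continuous_const)

instance : T2Space MatingSphere := .of_injective_continuous toCone_injective continuous_toCone

instance : CompactSpace MatingSphere := Quot.compactSpace

instance : LocallyPathConnectedSpace MatingSphere := Quot.locallyPathConnectedSpace

theorem side_injective (i : Bool) : Function.Injective (side i) := by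
  intro c c' h
  have := congrArg (fun y => (toCone y).1) h
  cases i with
  | false =>
    simp only [toCone, lift_side, cond_false] at this
    exact toDisk_injective this
  | true =>
    simp only [toCone, lift_side, cond_true] at this
    exact toDisk_injective ((starRingEnd ℂ).injective this)

theorem eq_of_side_point_eq {i k : Bool} {z : ℂ} {c : ClosedPlane}
    (h : side i (point z) = side k c) : i = k ∧ c = point z := by
  have hik : i = k := by
    have := congrArg (fun y => (toCone y).2) h
    have h1 := norm_toDisk_point_lt z
    have h2 := norm_toDisk_le c
    cases i <;> cases k <;> simp only [toCone, lift_side, cond_false, cond_true] at this ⊢ <;>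
      linarith
  subst hik
  exact ⟨rfl, (side_injective _ h).symm⟩

/-- The two open hemispheres of the mating sphere. -/
def hemisphere (i : Bool) (z : ℂ) : MatingSphere := side i (point z)

theorem continuous_hemisphere (i : Bool) : Continuous (hemisphere i) :=
  (continuous_side i).comp continuous_point

theorem hemisphere_eq_iff {i k : Bool} {z w : ℂ} :
    hemisphere i z = hemisphere k w ↔ i = k ∧ z = w := by
  refine ⟨fun h => ?_, by rintro ⟨rfl, rfl⟩; rfl⟩
  obtain ⟨h1, h2⟩ := eq_of_side_point_eq h
  exact ⟨h1, (point_injective h2).symm⟩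

theorem hemisphere_ne_infinity {i k : Bool} {z : ℂ} {ζ : Circle} :
    hemisphere i z ≠ side k (infinity ζ) := by
  intro h
  have := (eq_of_side_point_eq h).2
  cases this

theorem isOpenEmbedding_hemisphere (i : Bool) : IsOpenEmbedding (hemisphere i) := by
  refine .of_continuous_injective_isOpenMap (continuous_hemisphere i)
    ((side_injective i).comp point_injective) fun U hU => isOpen_iff.mpr fun k => ?_
  by_cases h : i = k
  · subst h
    rw [show hemisphere i '' U = side i '' (point '' U) by rw [Set.image_image]; rfl,
      Set.preimage_image_eq _ (side_injective i)]
    exact isOpenEmbedding_point.isOpenMap U hU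
  · convert isOpen_empty
    refine Set.eq_empty_of_forall_notMem ?_
    rintro c ⟨z, -, hz⟩
    exact h (eq_of_side_point_eq hz).1

theorem isClosedMap_side (i : Bool) : IsClosedMap (side i) := (continuous_side i).isClosedMap

end MatingSphere

/-! ### Polynomials near infinity, near critical points, and their fibers -/

section Polynomial

open Polynomial ClosedPlane

/-- The polynomial `p` of degree `d` in the coordinate of the closed disk, homogenized by the
distance to the boundary. -/
noncomputable def Polynomial.diskHomogenization (p : ℂ[X]) (d : ℕ) (x : ℂ) : ℂ :=
  ∑ k ∈ Finset.range (d + 1), p.coeff k * x ^ k * ((1 - ‖x‖ : ℝ) : ℂ) ^ (d - k)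

theorem Polynomial.continuous_diskHomogenization (p : ℂ[X]) (d : ℕ) :
    Continuous (p.diskHomogenization d) := by
  unfold Polynomial.diskHomogenization
  have : Continuous fun x : ℂ => ((1 - ‖x‖ : ℝ) : ℂ) :=
    Complex.continuous_ofReal.comp (by fun_prop)
  fun_prop

theorem Polynomial.diskHomogenization_toDisk_point {p : ℂ[X]} {d : ℕ} (hd : p.natDegree = d)
    (z : ℂ) : p.diskHomogenization d (toDisk (point z)) =
      (((1 + ‖z‖)⁻¹ : ℝ) : ℂ) ^ d * p.eval z := by
  rw [Polynomial.diskHomogenization, one_sub_norm_toDisk_point, eval_eq_sum_range, hd,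
    Finset.mul_sum]
  refine Finset.sum_congr rfl fun k hk => ?_
  have hk' : k ≤ d := by simpa [Nat.lt_succ_iff] using hk
  rw [toDisk_point, div_eq_mul_inv, ← Complex.ofReal_inv]
  conv_rhs => rw [← Nat.sub_add_cancel hk']
  rw [pow_add, mul_pow]
  ring

theorem Polynomial.diskHomogenization_toDisk_infinity {p : ℂ[X]} (hp : p.Monic) {d : ℕ}
    (hd : p.natDegree = d) (ζ : Circle) :
    p.diskHomogenization d (toDisk (infinity ζ)) = (ζ : ℂ) ^ d := by
  rw [Polynomial.diskHomogenization, norm_toDisk_infinity, Finset.sum_eq_single d]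
  · rw [← hd, hp.coeff_natDegree]
    simp
  · intro k hk hkd
    have : d - k ≠ 0 := by
      have : k < d + 1 := by simpa using hk
      omega
    simp [this]
  · simp

/-- Multiplying numerator and denominator of `p(z) / (1 + ‖p(z)‖)` by `(1 - ‖x‖) ^ d = (1 + ‖z‖)⁻¹ ^
d`, with `x` the disk coordinate of `z`, gives a formula that still makes sense on the boundary
circle. There monicity turns it into `ζ ^ d`, so one expression yields continuity everywhere. -/
theorem toDisk_extend {p : ℂ[X]} (hp : p.Monic) {d : ℕ} (hd : p.natDegree = d) (hd0 : d ≠ 0)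
    (c : ClosedPlane) :
    toDisk (extend d (fun z => p.eval z) c) = p.diskHomogenization d (toDisk c) /
      (((1 - ‖toDisk c‖) ^ d + ‖p.diskHomogenization d (toDisk c)‖ : ℝ) : ℂ) := by
  cases c with
  | point z =>
    rw [Polynomial.diskHomogenization_toDisk_point hd, one_sub_norm_toDisk_point, norm_mul,
      norm_pow, Complex.norm_real, Real.norm_of_nonneg (by positivity)]
    have h1 : (((1 + ‖z‖)⁻¹ : ℝ) : ℂ) ^ d ≠ 0 := by
      have : (1 + ‖z‖)⁻¹ ≠ 0 := by positivity
      exact pow_ne_zero _ (by exact_mod_cast this)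
    change toDisk (point (p.eval z)) = _
    rw [toDisk_point]
    push_cast at h1 ⊢
    rw [← mul_one_add, mul_div_mul_left _ _ h1]
  | infinity ζ =>
    rw [Polynomial.diskHomogenization_toDisk_infinity hp hd, norm_toDisk_infinity]
    change toDisk (infinity (ζ ^ d)) = _
    simp [hd0, Circle.norm_coe]

theorem continuous_extend {p : ℂ[X]} (hp : p.Monic) {d : ℕ} (hd : p.natDegree = d)
    (hd0 : d ≠ 0) : Continuous (extend d (fun z => p.eval z)) := by
  refine isEmbedding_toDisk.continuous_iff.mpr ?_
  rw [show toDisk ∘ extend d (fun z => p.eval z) = _ from funext (toDisk_extend hp hd hd0)]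
  have h1 := (p.continuous_diskHomogenization d).comp continuous_toDisk
  have h2 := continuous_toDisk
  refine h1.div (Complex.continuous_ofReal.comp ?_) fun c => ?_
  · exact ((continuous_const.sub h2.norm).pow d).add h1.norm
  · have : 0 < (1 - ‖toDisk c‖) ^ d + ‖p.diskHomogenization d (toDisk c)‖ := by
      cases c with
      | point z =>
        have := norm_toDisk_point_lt z
        have : 0 < (1 - ‖toDisk (point z)‖) ^ d := pow_pos (by linarith) d
        positivity
      | infinity ζ =>
        rw [Polynomial.diskHomogenization_toDisk_infinity hp hd, norm_toDisk_infinity]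
        simp [hd0, Circle.norm_coe]
    exact_mod_cast this.ne'

/-- Writing `T n` for the sum with `n` terms, `T (n + 1) = a * T n + b ^ n ≥ A * T n`; since `1 ≤
A`, `T` is also monotone. This lets the leading term dominate the lower ones in a difference
quotient. -/
theorem sum_pow_mul_pow_le {a b A : ℝ} (hA : 1 ≤ A) (ha : A ≤ a) (hb : A ≤ b) {k d : ℕ}
    (hk : k < d) : A * ∑ i ∈ Finset.range k, a ^ i * b ^ (k - 1 - i) ≤
      ∑ i ∈ Finset.range d, a ^ i * b ^ (d - 1 - i) := by
  have ha0 : 0 ≤ a := by linarith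
  have hb0 : 0 ≤ b := by linarith
  have h0 : ∀ n, 0 ≤ ∑ i ∈ Finset.range n, a ^ i * b ^ (n - 1 - i) := fun n => by positivity
  have step : ∀ n, A * ∑ i ∈ Finset.range n, a ^ i * b ^ (n - 1 - i) ≤
      ∑ i ∈ Finset.range (n + 1), a ^ i * b ^ (n + 1 - 1 - i) := fun n => by
    rw [Finset.sum_range_succ']
    have h1 : ∑ i ∈ Finset.range n, a ^ (i + 1) * b ^ (n + 1 - 1 - (i + 1)) =
        a * ∑ i ∈ Finset.range n, a ^ i * b ^ (n - 1 - i) := by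
      rw [Finset.mul_sum]
      refine Finset.sum_congr rfl fun i _ => ?_
      rw [pow_succ, show n + 1 - 1 - (i + 1) = n - 1 - i by omega]
      ring
    rw [h1]
    have := mul_le_mul_of_nonneg_right ha (h0 n)
    have : 0 ≤ a ^ 0 * b ^ (n + 1 - 1 - 0) := by positivity
    linarith
  refine (step k).trans ?_
  refine monotone_nat_of_le_succ (f := fun n => ∑ i ∈ Finset.range n, a ^ i * b ^ (n - 1 - i))
    (fun n => ?_) hk
  have := step n
  have := mul_le_mul_of_nonneg_right hA (h0 n)
  linarith

theorem Polynomial.eval_sub_eval_eq (p : ℂ[X]) (z w : ℂ) :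
    p.eval z - p.eval w = (∑ k ∈ Finset.range (p.natDegree + 1),
      p.coeff k * ∑ i ∈ Finset.range k, z ^ i * w ^ (k - 1 - i)) * (z - w) := by
  rw [eval_eq_sum_range, eval_eq_sum_range, ← Finset.sum_sub_distrib, Finset.sum_mul]
  refine Finset.sum_congr rfl fun k _ => ?_
  rw [mul_assoc, geom_sum₂_mul]
  ring

/-- Near a point at infinity the extension of a monic polynomial is injective. -/
theorem exists_injOn_extend {p : ℂ[X]} (hp : p.Monic) {d : ℕ} (hd : p.natDegree = d)
    (hd0 : d ≠ 0) (ζ : Circle) :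
    ∃ N ∈ 𝓝 (infinity ζ), Set.InjOn (extend d (fun z => p.eval z)) N := by
  -- This rotation sends `ζ ^ (d - 1)` to `1`, so every product `v₁ ^ i * v₂ ^ (d - 1 - i)` with
  -- `v₁, v₂` near `ζ` acquires real part above `1 / 2`.
  set u : ℂ := (starRingEnd ℂ) (ζ : ℂ) ^ (d - 1) with hu
  have hnu : ‖u‖ = 1 := by rw [hu, norm_pow, RCLike.norm_conj, Circle.norm_coe, one_pow]
  -- Chosen so that the lower coefficients sum in norm to `(A - 1) / 2`: once `1 + ‖z‖` and `1 +
  -- ‖w‖` are at least `A`, their contribution is at most `(A - 1) / (2 * A) * T d`, strictly below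
  -- the leading `T d / 2`.
  set A : ℝ := 2 * ∑ k ∈ Finset.range d, ‖p.coeff k‖ + 1 with hA
  have hA1 : 1 ≤ A := by
    have : 0 ≤ ∑ k ∈ Finset.range d, ‖p.coeff k‖ := by positivity
    linarith
  have hev : ∀ᶠ v : ℂ × ℂ in 𝓝 ((ζ : ℂ), (ζ : ℂ)),
      ∀ i ∈ Finset.range d, 1 / 2 < (u * (v.1 ^ i * v.2 ^ (d - 1 - i))).re := by
    rw [Filter.eventually_all_finset]
    intro i hi
    have hcont : Continuous fun v : ℂ × ℂ => (u * (v.1 ^ i * v.2 ^ (d - 1 - i))).re := by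
      fun_prop
    refine hcont.continuousAt.eventually (lt_mem_nhds ?_)
    have hi' : i ≤ d - 1 := by
      have : i < d := by simpa using hi
      omega
    change 1 / 2 < (u * ((ζ : ℂ) ^ i * (ζ : ℂ) ^ (d - 1 - i))).re
    rw [← pow_add, Nat.add_sub_cancel' hi', hu, ← mul_pow, ← Complex.normSq_eq_conj_mul_self,
      Circle.normSq_coe]
    norm_num
  rw [nhds_prod_eq] at hev
  obtain ⟨V, hV, hVre⟩ := (Filter.eventually_prod_self_iff (r := fun x y : ℂ =>
    ∀ i ∈ Finset.range d, 1 / 2 < (u * (x ^ i * y ^ (d - 1 - i))).re)).mp hev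
  refine ⟨toDisk ⁻¹' V ∩ {c | 1 - ‖toDisk c‖ < A⁻¹}, Filter.inter_mem
    (continuous_toDisk.continuousAt hV) ?_, ?_⟩
  · refine (isOpen_lt (continuous_const.sub continuous_toDisk.norm) continuous_const).mem_nhds ?_
    change 1 - ‖toDisk (infinity ζ)‖ < A⁻¹
    rw [norm_toDisk_infinity, sub_self]
    positivity
  rintro (z | ξ) ⟨hz, hz'⟩ (w | ξ') ⟨hw, hw'⟩ h
  · replace h : p.eval z = p.eval w := point_injective h
    congr 1
    by_contra hne
    have h0 := p.eval_sub_eval_eq z w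
    rw [h, sub_self] at h0
    replace h0 := (mul_eq_zero.mp h0.symm).resolve_right (sub_ne_zero.mpr hne)
    set a : ℝ := 1 + ‖z‖ with ha
    set b : ℝ := 1 + ‖w‖ with hb
    have ha0 : 0 < a := by positivity
    have hb0 : 0 < b := by positivity
    have hAa : A ≤ a := by
      change 1 - ‖toDisk (point z)‖ < A⁻¹ at hz'
      rw [one_sub_norm_toDisk_point] at hz'
      exact ((inv_lt_inv₀ ha0 (by positivity)).mp hz').le
    have hAb : A ≤ b := by
      change 1 - ‖toDisk (point w)‖ < A⁻¹ at hw'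
      rw [one_sub_norm_toDisk_point] at hw'
      exact ((inv_lt_inv₀ hb0 (by positivity)).mp hw').le
    set T : ℕ → ℝ := fun n => ∑ i ∈ Finset.range n, a ^ i * b ^ (n - 1 - i) with hT
    have hTpos : 0 < T d := Finset.sum_pos (fun i _ => by positivity)
      (Finset.nonempty_range_iff.mpr hd0)
    -- Splitting off the positive factors `a` and `b` reduces the leading sum to products of disk
    -- coordinates, which lie in `V`.
    have hz1 : z = a * toDisk (point z) := by
      rw [toDisk_point, ← ha]
      have : (a : ℂ) ≠ 0 := by exact_mod_cast ha0.ne'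
      field_simp
    have hw1 : w = b * toDisk (point w) := by
      rw [toDisk_point, ← hb]
      have : (b : ℂ) ≠ 0 := by exact_mod_cast hb0.ne'
      field_simp
    have hlead : T d / 2 ≤ (u * ∑ i ∈ Finset.range d, z ^ i * w ^ (d - 1 - i)).re := by
      rw [Finset.mul_sum, Complex.re_sum, hT, Finset.sum_div]
      refine Finset.sum_le_sum fun i hi => ?_
      have h1 := hVre _ hz _ hw i hi
      have h2 : u * (z ^ i * w ^ (d - 1 - i)) = ((a ^ i * b ^ (d - 1 - i) : ℝ) : ℂ) *
          (u * (toDisk (point z) ^ i * toDisk (point w) ^ (d - 1 - i))) := by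
        nth_rw 1 [hz1, hw1]
        push_cast
        ring
      rw [h2, Complex.re_ofReal_mul]
      have : 0 < a ^ i * b ^ (d - 1 - i) := by positivity
      nlinarith
    have hrest : ‖∑ k ∈ Finset.range d, p.coeff k * ∑ i ∈ Finset.range k, z ^ i * w ^ (k - 1 - i)‖
        * A ≤ (∑ k ∈ Finset.range d, ‖p.coeff k‖) * T d := by
      rw [Finset.sum_mul]
      refine (mul_le_mul_of_nonneg_right (norm_sum_le _ _) (by positivity)).trans ?_
      rw [Finset.sum_mul]
      refine Finset.sum_le_sum fun k hk => ?_
      rw [norm_mul, mul_assoc]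
      refine mul_le_mul_of_nonneg_left ?_ (norm_nonneg _)
      refine le_trans ?_ (sum_pow_mul_pow_le hA1 hAa hAb (by simpa using hk))
      rw [mul_comm]
      refine mul_le_mul_of_nonneg_left ?_ (by positivity)
      refine (norm_sum_le _ _).trans (Finset.sum_le_sum fun i _ => ?_)
      rw [norm_mul, norm_pow, norm_pow]
      gcongr <;> linarith
    rw [hd, Finset.sum_range_succ, ← hd, hp.coeff_natDegree, hd, one_mul] at h0
    have h1 := congrArg (fun v => (u * v).re) h0
    simp only [mul_add, Complex.add_re, mul_zero, Complex.zero_re] at h1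
    set R : ℂ := ∑ k ∈ Finset.range d, p.coeff k * ∑ i ∈ Finset.range k, z ^ i * w ^ (k - 1 - i)
    have h2 : -‖R‖ ≤ (u * R).re := by
      have := neg_le_of_abs_le (Complex.abs_re_le_norm (u * R))
      rwa [norm_mul, hnu, one_mul] at this
    have h3 : T d / 2 ≤ ‖R‖ := by linarith
    have h4 : T d / 2 * A ≤ ‖R‖ * A := mul_le_mul_of_nonneg_right h3 (by positivity)
    have h5 : (∑ k ∈ Finset.range d, ‖p.coeff k‖) = (A - 1) / 2 := by rw [hA]; ring
    rw [h5] at hrest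
    nlinarith
  · cases h
  · cases h
  · replace h : ξ ^ d = ξ' ^ d := by
      change infinity _ = infinity _ at h
      injection h
    congr 1
    by_contra hne
    have h1 : (ξ : ℂ) ^ d - (ξ' : ℂ) ^ d = 0 := by
      rw [← Circle.coe_pow, ← Circle.coe_pow, h, sub_self]
    rw [← geom_sum₂_mul] at h1
    replace h1 := (mul_eq_zero.mp h1).resolve_right
      (sub_ne_zero.mpr fun h => hne (Circle.coe_injective h))
    have h2 := congrArg (fun v => (u * v).re) h1
    simp only [mul_zero, Complex.zero_re, Finset.mul_sum, Complex.re_sum] at h2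
    have h3 : 0 < ∑ i ∈ Finset.range d, (u * ((ξ : ℂ) ^ i * (ξ' : ℂ) ^ (d - 1 - i))).re :=
      Finset.sum_pos (fun i hi => by
        have := hVre _ hz _ hw i hi
        simp only [toDisk_infinity] at this
        linarith) (Finset.nonempty_range_iff.mpr hd0)
    exact h3.ne' h2

/-- A polynomial map is not locally injective at the zeros of its derivative. -/
theorem mem_criticalSet_of_derivative_eq_zero {p : ℂ[X]} (hp : p.natDegree ≠ 0) {x : ℂ}
    (hx : p.derivative.eval x = 0) : x ∈ criticalSet fun z => p.eval z := by
  rintro ⟨U, hU, hinj⟩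
  set r : ℂ[X] := p - C (p.eval x) with hr
  have hr0 : r ≠ 0 := by
    intro h
    rw [hr, sub_eq_zero] at h
    exact hp (by rw [h, natDegree_C])
  have hm : 1 < r.rootMultiplicity x := by
    rw [one_lt_rootMultiplicity_iff_isRoot hr0]
    simp [hr, hx]
  obtain ⟨g, hg, hgx⟩ := exists_eq_pow_rootMultiplicity_mul_and_not_dvd r hr0 x
  rw [dvd_iff_isRoot] at hgx
  set m := r.rootMultiplicity x
  have hgx0 : g.eval x ≠ 0 := hgx
  have hm0 : m ≠ 0 := by omega
  -- A local coordinate in which `p - p(x)` is a constant times an `m`-th power. The quotient is `1`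
  -- at `x`, hence in the slit plane nearby, so the principal branch is differentiable there and `φ`
  -- has derivative `1`.
  set φ : ℂ → ℂ := fun z => (z - x) * (g.eval z / g.eval x) ^ ((m : ℂ)⁻¹) with hφ
  have hφm : ∀ z, φ z ^ m * g.eval x = p.eval z - p.eval x := by
    intro z
    have : r.eval z = (z - x) ^ m * g.eval z := by
      conv_lhs => rw [hg]
      simp
    rw [hr, eval_sub, eval_C] at this
    rw [this, hφ, mul_pow, Complex.cpow_nat_inv_pow _ hm0]
    field_simp
  have hderiv : HasStrictDerivAt φ 1 x := by
    have h1 : HasStrictDerivAt (fun z => g.eval z / g.eval x)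
        (g.derivative.eval x / g.eval x) x := (g.hasStrictDerivAt x).div_const _
    have h2 := h1.cpow_const (c := (m : ℂ)⁻¹) (by rw [div_self hgx0]; exact Complex.one_mem_slitPlane)
    have h0 : HasStrictDerivAt (fun z : ℂ => z - x) 1 x := (hasStrictDerivAt_id x).sub_const x
    have h3 := h0.mul h2
    rw [div_self hgx0, Complex.one_cpow, sub_self, zero_mul, one_mul, add_zero] at h3
    exact h3
  have hφx : φ x = 0 := by simp [hφ]
  have hmap := hderiv.map_nhds_eq one_ne_zero
  rw [hφx] at hmap
  have hU' : φ '' U ∈ 𝓝 (0 : ℂ) := hmap ▸ Filter.image_mem_map hU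
  set ω : ℂ := Complex.exp (2 * Real.pi * Complex.I / m)
  have hω : IsPrimitiveRoot ω m := Complex.isPrimitiveRoot_exp m hm0
  have hU'' : (fun w => ω * w) ⁻¹' (φ '' U) ∈ 𝓝 (0 : ℂ) := by
    refine (continuous_const_mul ω).continuousAt ?_
    rwa [mul_zero]
  -- Both `w ≠ 0` and `ω * w` are values of `φ` on `U`. Their `m`-th powers agree, so injectivity of
  -- `p` on `U` would force `w = ω * w`, impossible because `m > 1`.
  obtain ⟨w, ⟨⟨a, ha, haw⟩, ⟨b, hb, hbw⟩⟩, hw0⟩ := (Filter.nonempty_of_mem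
    (Filter.inter_mem (mem_nhdsWithin_of_mem_nhds (Filter.inter_mem hU' hU''))
      (self_mem_nhdsWithin (a := (0 : ℂ)) (s := {0}ᶜ))))
  have hab : a = b := by
    refine hinj ha hb ?_
    have h1 := hφm a
    have h2 := hφm b
    simp only at hbw
    rw [haw] at h1
    rw [hbw, mul_pow, hω.pow_eq_one, one_mul, h1] at h2
    simpa using h2
  subst hab
  have h3 : (ω - 1) * w = 0 := by
    simp only at hbw
    rw [sub_mul, ← hbw, haw]
    ring
  rcases mul_eq_zero.mp h3 with h | h
  · exact hω.ne_one hm (sub_eq_zero.mp h)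
  · exact hw0 h

/-- A value of a polynomial of degree `d` which is not critical has `d` preimages. -/
theorem ncard_preimage_eval {p : ℂ[X]} {d : ℕ} (hd : p.natDegree = d) (hd0 : d ≠ 0) {y : ℂ}
    (hy : ∀ x, p.eval x = y → p.derivative.eval x ≠ 0) :
    ((fun z => p.eval z) ⁻¹' {y}).ncard = d := by
  set r : ℂ[X] := p - C y with hr
  have hrd : r.natDegree = d := by rw [hr, natDegree_sub_C, hd]
  have hr0 : r ≠ 0 := by
    rintro h
    rw [h, natDegree_zero] at hrd
    exact hd0 hrd.symm
  -- A repeated root would be a critical preimage of `y`.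
  have hnodup : r.roots.Nodup := by
    refine Multiset.nodup_iff_count_le_one.mpr fun x => ?_
    rw [count_roots]
    by_contra! h
    rw [one_lt_rootMultiplicity_iff_isRoot hr0] at h
    simp only [hr, IsRoot.def, eval_sub, eval_C, derivative_sub, derivative_C, sub_zero] at h
    exact hy x (sub_eq_zero.mp h.1) h.2
  have hset : (fun z => p.eval z) ⁻¹' {y} = (r.roots.toFinset : Set ℂ) := by
    ext x
    rw [Finset.mem_coe, Multiset.mem_toFinset, mem_roots hr0]
    simp [hr, sub_eq_zero]
  rw [hset, Set.ncard_coe_finset, Multiset.toFinset_card_of_nodup hnodup,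
    ← (IsAlgClosed.splits r).natDegree_eq_card_roots, hrd]

end Polynomial

/-! ### Coverings from fiber counting -/

/-- A continuous closed map from a Hausdorff space which is locally injective and all of whose
fibers have the same finite number of points is a covering map. -/
theorem isCoveringMap_of_ncard_fiber_eq {E B : Type*} [TopologicalSpace E] [TopologicalSpace B]
    [T2Space E] {q : E → B} (hc : Continuous q) (hcl : IsClosedMap q)
    (hinj : ∀ x, ∃ U ∈ 𝓝 x, Set.InjOn q U) {d : ℕ} (hd : d ≠ 0)
    (hcard : ∀ y, (q ⁻¹' {y}).ncard = d) : IsCoveringMap q := by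
  intro y
  have hfin : ∀ y, (q ⁻¹' {y}).Finite := fun y =>
    Set.finite_of_ncard_ne_zero (by rw [hcard]; exact hd)
  obtain ⟨U, hU, hUd⟩ := (hfin y).t2_separation
  choose N hN hNi using hinj
  set W : E → Set E := fun x => U x ∩ interior (N x) with hW
  have hWo : ∀ x, IsOpen (W x) := fun x => (hU x).2.inter isOpen_interior
  have hxW : ∀ x, x ∈ W x := fun x => ⟨(hU x).1, mem_interior_iff_mem_nhds.mpr (hN x)⟩
  have hWi : ∀ x, (W x).InjOn q := fun x =>
    (hNi x).mono (Set.inter_subset_right.trans interior_subset)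
  have hWd : ∀ x x' : q ⁻¹' {y}, x ≠ x' → Disjoint (W x) (W x') := fun x x' h =>
    (hUd x.2 x'.2 fun h' => h (Subtype.ext h')).mono Set.inter_subset_left Set.inter_subset_left
  -- The points whose entire fiber lies in the chosen neighbourhoods; open because `q` is closed.
  set V : Set B := (q '' (⋃ x : q ⁻¹' {y}, W x)ᶜ)ᶜ with hV
  have hVo : IsOpen V := (hcl _ (isOpen_iUnion fun x => hWo _).isClosed_compl).isOpen_compl
  have hVW : ∀ x, q x ∈ V → ∃ e : q ⁻¹' {y}, x ∈ W e := fun x hx => by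
    by_contra h
    exact hx ⟨x, fun h' => h (Set.mem_iUnion.mp h'), rfl⟩
  have hyV : y ∈ V := by
    rintro ⟨x, hx, hxy⟩
    exact hx (Set.mem_iUnion.mpr ⟨⟨x, hxy⟩, hxW x⟩)
  set S : q ⁻¹' {y} → Set E := fun e => W e ∩ q ⁻¹' V with hS
  have hsurj : ∀ e, (S e).SurjOn q V := by
    intro e y' hy'
    choose g hg using fun x : q ⁻¹' {y'} => hVW x (by rw [show q x = y' from x.2]; exact hy')
    have hginj : Function.Injective g := fun x x' h => by
      refine Subtype.ext (hWi (g x) (hg x) (h ▸ hg x') ?_)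
      exact (show q x = y' from x.2).trans (show q x' = y' from x'.2).symm
    have : Finite (q ⁻¹' {y}) := hfin y
    have : Finite (q ⁻¹' {y'}) := hfin y'
    -- Each neighbourhood contains at most one point of the fiber over `y'`; since this fiber has as
    -- many points as that over `y`, each contains exactly one.
    have hbij : Function.Bijective g := by
      refine (Nat.bijective_iff_injective_and_card g).mpr ⟨hginj, ?_⟩
      exact (hcard y').trans (hcard y).symm
    obtain ⟨x, rfl⟩ := hbij.2 e
    have hx : q x = y' := x.2
    exact ⟨x, ⟨hg x, by rw [Set.mem_preimage, hx]; exact hy'⟩, hx⟩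
  have hne : Nonempty (q ⁻¹' {y}) := by
    refine (Set.nonempty_of_ncard_ne_zero ?_).to_subtype
    rw [hcard]
    exact hd
  have : Nonempty (B → E) := ⟨fun _ => hne.some⟩
  let _ : TopologicalSpace (q ⁻¹' {y}) := ⊥
  have : DiscreteTopology (q ⁻¹' {y}) := ⟨rfl⟩
  refine (IsEvenlyCovered.of_trivialization (I := q ⁻¹' {y})
    (t := IsOpen.trivializationDiscrete (f := q) S V hVo ?_ ?_ hsurj ?_ ?_)
    hyV).to_isEvenlyCovered_preimage
  · intro e A hA
    refine ⟨fun h => (h.preimage hc).inter ((hWo _).inter (hVo.preimage hc)), fun h => ?_⟩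
    -- Openness downstairs comes from closedness of `q`: a point of `V` is in `A` exactly when its
    -- preimage in sheet `e` lies over `A`, the other preimages being absorbed by the other
    -- neighbourhoods.
    have hA' : A = V ∩ (q '' ((q ⁻¹' A ∩ S e) ∪ ⋃ e' : {e' // e' ≠ e}, W e'.1)ᶜ)ᶜ := by
      ext y'
      constructor
      · refine fun hy' => ⟨hA hy', ?_⟩
        rintro ⟨x, hx, rfl⟩
        obtain ⟨e', he'⟩ := hVW x (hA hy')
        apply hx
        by_cases hee : e' = e
        · subst hee
          exact .inl ⟨hy', he', hA hy'⟩
        · exact .inr (Set.mem_iUnion.mpr ⟨⟨e', hee⟩, he'⟩)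
      · rintro ⟨hy', hy''⟩
        obtain ⟨x, hx, rfl⟩ := hsurj e hy'
        by_contra hxA
        refine hy'' ⟨x, ?_, rfl⟩
        rintro (hx' | hx')
        · exact hxA hx'.1
        · obtain ⟨e', he'⟩ := Set.mem_iUnion.mp hx'
          exact (hWd _ _ e'.2).le_bot ⟨he', hx.1⟩
    rw [hA']
    exact hVo.inter (hcl _ (h.union (isOpen_iUnion fun e' => hWo _)).isClosed_compl).isOpen_compl
  · exact fun e => (hWi e).mono Set.inter_subset_left
  · exact fun e e' h => (hWd e e' h).mono Set.inter_subset_left Set.inter_subset_left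
  · intro x hx
    obtain ⟨e, he⟩ := hVW x hx
    exact Set.mem_iUnion.mpr ⟨e, he, hx⟩

theorem map_mem_postcriticalSet {X : Type*} [TopologicalSpace X] {f : X → X} {x : X}
    (hx : x ∈ postcriticalSet f) : f x ∈ postcriticalSet f := by
  obtain ⟨n, c, hc, rfl⟩ := Set.mem_iUnion.mp hx
  exact Set.mem_iUnion.mpr ⟨n + 1, c, hc, Function.iterate_succ_apply' f (n + 1) c⟩

theorem map_mem_postcriticalSet_of_mem_criticalSet {X : Type*} [TopologicalSpace X] {f : X → X}
    {x : X} (hx : x ∈ criticalSet f) : f x ∈ postcriticalSet f :=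
  Set.mem_iUnion.mpr ⟨0, x, hx, rfl⟩

/-- A post-critically finite closed map all of whose fibers over the complement of the
post-critical set have `d` points is a partial self-covering of this complement. -/
theorem isPartialSelfCovering_compl_postcriticalSet {X : Type*} [TopologicalSpace X] [T2Space X]
    [LocallyPathConnectedSpace X] {f : X → X} (hc : Continuous f) (hcl : IsClosedMap f)
    (hfin : IsPostcriticallyFinite f) (hpath : IsPathConnected (postcriticalSet f)ᶜ) {d : ℕ}
    (hd : 2 ≤ d) (hcard : ∀ y ∈ (postcriticalSet f)ᶜ, (f ⁻¹' {y}).ncard = d) :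
    IsPartialSelfCovering f (postcriticalSet f)ᶜ d where
  isPathConnected := hpath
  locallyPathConnected := (Set.Finite.isClosed hfin).isOpen_compl.locallyPathConnectedSpace
  preimage_subset _ hx hx' := hx (map_mem_postcriticalSet hx')
  isCoveringMap := by
    refine isCoveringMap_of_ncard_fiber_eq hc.restrictPreimage (hcl.restrictPreimage _)
      (fun x => ?_) (by omega : d ≠ 0) fun y => ?_
    · have hx : x.1 ∉ criticalSet f := fun h => x.2 (map_mem_postcriticalSet_of_mem_criticalSet h)
      obtain ⟨U, hU, hUi⟩ := not_not.mp hx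
      refine ⟨Subtype.val ⁻¹' U, continuous_subtype_val.continuousAt hU, fun a ha b hb hab => ?_⟩
      exact Subtype.ext (hUi ha hb (congrArg Subtype.val hab))
    · rw [← hcard y y.2, ← Set.ncard_image_of_injective _ Subtype.val_injective]
      congr 1
      ext x
      constructor
      · rintro ⟨x, hx, rfl⟩
        exact congrArg Subtype.val hx
      · intro hx
        have hx' : f x = y := hx
        exact ⟨⟨x, by rw [Set.mem_preimage, hx']; exact y.2⟩, Subtype.ext hx', rfl⟩
  two_le_degree := hd
  degree_eq := hcard

open Polynomial in
theorem ncard_preimage_of_notMem_postcriticalSet {p : ℂ[X]} {d : ℕ} (hd : p.natDegree = d)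
    (hd0 : d ≠ 0) {y : ℂ} (hy : y ∉ postcriticalSet fun z => p.eval z) :
    ((fun z => p.eval z) ⁻¹' {y}).ncard = d := by
  refine ncard_preimage_eval hd hd0 fun x hx h => hy ?_
  rw [← hx]
  exact map_mem_postcriticalSet_of_mem_criticalSet
    (mem_criticalSet_of_derivative_eq_zero (by rwa [hd]) h)

theorem isPathConnected_compl_of_finite {s : Set ℂ} (hs : s.Finite) : IsPathConnected sᶜ :=
  hs.countable.isPathConnected_compl_of_one_lt_rank (by rw [Complex.rank_real_complex]; norm_num)

open Polynomial in
theorem isPartialSelfCovering_eval {p : ℂ[X]} {d : ℕ} (hd : 2 ≤ d) (hpd : p.natDegree = d)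
    (hfin : IsPostcriticallyFinite fun z => p.eval z) :
    IsPartialSelfCovering (fun z => p.eval z) (postcriticalSet fun z => p.eval z)ᶜ d :=
  isPartialSelfCovering_compl_postcriticalSet p.continuous p.isClosedMap_eval hfin
    (isPathConnected_compl_of_finite hfin) hd fun _ hy =>
      ncard_preimage_of_notMem_postcriticalSet hpd (by omega) hy

/-- The `d`-th roots of `ζ` in `ℂ` are simple, since `0` is not among them, and all have modulus
`1`. -/
theorem Circle.ncard_pow_eq {d : ℕ} (hd : d ≠ 0) (ζ : Circle) :
    {ξ : Circle | ξ ^ d = ζ}.ncard = d := by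
  refine (Set.ncard_image_of_injective _ Circle.coe_injective).symm.trans ?_
  refine Eq.trans ?_ (ncard_preimage_eval (p := Polynomial.X ^ d) (d := d) (y := (ζ : ℂ))
    (Polynomial.natDegree_X_pow d) hd fun x hx => ?_)
  · congr 1
    ext x
    simp only [Polynomial.eval_pow, Polynomial.eval_X]
    constructor
    · rintro ⟨ξ, hξ, rfl⟩
      exact congrArg Subtype.val (show ξ ^ d = ζ from hξ)
    · intro hx
      have hx' : x ^ d = ζ := hx
      have hn : ‖x‖ = 1 := by
        have := congrArg norm hx'
        rw [norm_pow, Circle.norm_coe] at this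
        exact (pow_eq_one_iff_of_nonneg (norm_nonneg x) hd).mp this
      exact ⟨⟨x, mem_sphere_zero_iff_norm.mpr hn⟩, Circle.coe_injective hx', rfl⟩
  · rw [Polynomial.eval_pow, Polynomial.eval_X] at hx
    have hx0 : x ≠ 0 := by
      rintro rfl
      rw [zero_pow hd] at hx
      exact Circle.coe_ne_zero ζ hx.symm
    rw [Polynomial.derivative_X_pow, Polynomial.eval_mul, Polynomial.eval_C, Polynomial.eval_pow,
      Polynomial.eval_X]
    exact mul_ne_zero (by exact_mod_cast hd) (pow_ne_zero _ hx0)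

/-! ### Dynamics of the formal mating -/

open ClosedPlane MatingSphere

theorem formalMating_side (d : ℕ) (f : Bool → ℂ → ℂ) (i : Bool) (c : ClosedPlane) :
    formalMating d (f false) (f true) (side i c) = side i (extend d (f i) c) := by
  cases i <;> rfl

theorem formalMating_hemisphere (d : ℕ) (f : Bool → ℂ → ℂ) (i : Bool) (z : ℂ) :
    formalMating d (f false) (f true) (hemisphere i z) = hemisphere i (f i z) :=
  formalMating_side d f i (point z)

theorem formalMating_infinity (d : ℕ) (f : Bool → ℂ → ℂ) (i : Bool) (ζ : Circle) :
    formalMating d (f false) (f true) (side i (infinity ζ)) = side i (infinity (ζ ^ d)) :=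
  formalMating_side d f i (infinity ζ)

theorem formalMating_eq_hemisphere {d : ℕ} {f : Bool → ℂ → ℂ} {i : Bool} {w : ℂ}
    {y : MatingSphere} (h : formalMating d (f false) (f true) y = hemisphere i w) :
    ∃ z, y = hemisphere i z ∧ f i z = w := by
  obtain ⟨k, z, rfl⟩ | ⟨ζ, rfl⟩ := exists_hemisphere_or_infinity y
  · change formalMating d (f false) (f true) (hemisphere k z) = _ at h
    rw [formalMating_hemisphere, hemisphere_eq_iff] at h
    obtain ⟨rfl, rfl⟩ := h
    exact ⟨z, rfl, rfl⟩
  · rw [formalMating_infinity] at h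
    exact absurd h.symm hemisphere_ne_infinity

theorem formalMating_iterate_hemisphere (d : ℕ) (f : Bool → ℂ → ℂ) (i : Bool) (n : ℕ) (z : ℂ) :
    (formalMating d (f false) (f true))^[n] (hemisphere i z) = hemisphere i ((f i)^[n] z) := by
  induction n generalizing z with
  | zero => rfl
  | succ n ih => rw [Function.iterate_succ_apply, formalMating_hemisphere, ih,
      Function.iterate_succ_apply]

theorem formalMating_iterate_eq_hemisphere {d : ℕ} {f : Bool → ℂ → ℂ} {i : Bool} {n : ℕ} {w : ℂ}
    {y : MatingSphere} (h : (formalMating d (f false) (f true))^[n] y = hemisphere i w) :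
    ∃ z, y = hemisphere i z ∧ (f i)^[n] z = w := by
  induction n generalizing y with
  | zero => exact ⟨w, h, rfl⟩
  | succ n ih =>
    rw [Function.iterate_succ_apply] at h
    obtain ⟨z, hz, hz'⟩ := ih h
    obtain ⟨z₀, rfl, rfl⟩ := formalMating_eq_hemisphere hz
    exact ⟨z₀, rfl, by rwa [Function.iterate_succ_apply]⟩

theorem continuous_formalMating {d : ℕ} {f : Bool → ℂ → ℂ}
    (hf : ∀ i, Continuous (extend d (f i))) :
    Continuous (formalMating d (f false) (f true)) := by
  refine continuous_iff.mpr fun i => ?_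
  rw [show formalMating d (f false) (f true) ∘ side i = side i ∘ extend d (f i) from
    funext fun c => formalMating_side d f i c]
  exact (continuous_side i).comp (hf i)

theorem hemisphere_mem_criticalSet_iff {d : ℕ} {f : Bool → ℂ → ℂ} {i : Bool} {z : ℂ} :
    hemisphere i z ∈ criticalSet (formalMating d (f false) (f true)) ↔
      z ∈ criticalSet (f i) := by
  refine not_congr ⟨?_, ?_⟩
  · rintro ⟨U, hU, hUi⟩
    refine ⟨hemisphere i ⁻¹' U, (continuous_hemisphere i).continuousAt hU, fun a ha b hb h => ?_⟩
    have := hUi ha hb (by rw [formalMating_hemisphere, formalMating_hemisphere, h])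
    exact (hemisphere_eq_iff.mp this).2
  · rintro ⟨V, hV, hVi⟩
    refine ⟨hemisphere i '' V, (isOpenEmbedding_hemisphere i).image_mem_nhds.mpr hV, ?_⟩
    rintro _ ⟨a, ha, rfl⟩ _ ⟨b, hb, rfl⟩ h
    rw [formalMating_hemisphere, formalMating_hemisphere, hemisphere_eq_iff] at h
    rw [hVi ha hb h.2]

/-- Points with the same image are in a common closed hemisphere, since preimages preserve the open
hemispheres and the equator. Injectivity on each side therefore suffices. -/
theorem infinity_notMem_criticalSet {d : ℕ} {f : Bool → ℂ → ℂ}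
    (hf : ∀ i ζ, ∃ N ∈ 𝓝 (infinity ζ), Set.InjOn (extend d (f i)) N) (ζ : Circle) :
    side false (infinity ζ) ∉ criticalSet (formalMating d (f false) (f true)) := by
  set ξ : Bool → Circle := fun i => cond i ζ⁻¹ ζ
  have hξ : ∀ i, side i (infinity (ξ i)) = side false (infinity ζ) := by
    rintro (_ | _)
    · rfl
    · exact (side_infinity false ζ).symm
  choose N hN hNi using fun i => hf i (ξ i)
  -- Taking complements of closed images glues the one-sided neighbourhoods into an open set of the
  -- sphere whose trace on side `i` lies in `N i`.
  refine not_not.mpr ⟨⋂ i, (side i '' (interior (N i))ᶜ)ᶜ, ?_, ?_⟩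
  · refine IsOpen.mem_nhds (isOpen_iInter_of_finite fun i =>
      (isClosedMap_side i _ isOpen_interior.isClosed_compl).isOpen_compl) ?_
    refine Set.mem_iInter.mpr fun i => ?_
    rintro ⟨c, hc, hc'⟩
    rw [← hξ i] at hc'
    rw [side_injective i hc'] at hc
    exact hc (mem_interior_iff_mem_nhds.mpr (hN i))
  · have key : ∀ i c c', side i c ∈ ⋂ i, (side i '' (interior (N i))ᶜ)ᶜ →
        side i c' ∈ ⋂ i, (side i '' (interior (N i))ᶜ)ᶜ →
        formalMating d (f false) (f true) (side i c) =
          formalMating d (f false) (f true) (side i c') → side i c = side i c' := by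
      intro i c c' hc hc' h
      rw [formalMating_side, formalMating_side] at h
      have hmem : ∀ c, side i c ∈ ⋂ i, (side i '' (interior (N i))ᶜ)ᶜ → c ∈ N i := by
        intro c hc
        by_contra hcN
        exact Set.mem_iInter.mp hc i ⟨c, fun h => hcN (interior_subset h), rfl⟩
      rw [hNi i (hmem c hc) (hmem c' hc') (side_injective i h)]
    intro y hy y' hy' h
    obtain ⟨i, z, rfl⟩ | ⟨η, rfl⟩ := exists_hemisphere_or_infinity y
    · have h2 := h.symm.trans (formalMating_hemisphere d f i z)
      obtain ⟨w, rfl, -⟩ := formalMating_eq_hemisphere h2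
      exact key i _ _ hy hy' h
    · obtain ⟨i, z, rfl⟩ | ⟨η', rfl⟩ := exists_hemisphere_or_infinity y'
      · have h2 := h.trans (formalMating_hemisphere d f i z)
        obtain ⟨w, hw, -⟩ := formalMating_eq_hemisphere h2
        exact absurd hw.symm hemisphere_ne_infinity
      · exact key false _ _ hy hy' h

theorem postcriticalSet_formalMating {d : ℕ} {f : Bool → ℂ → ℂ}
    (hf : ∀ i ζ, ∃ N ∈ 𝓝 (infinity ζ), Set.InjOn (extend d (f i)) N) :
    postcriticalSet (formalMating d (f false) (f true)) =
      ⋃ i, hemisphere i '' postcriticalSet (f i) := by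
  ext y
  constructor
  · intro hy
    obtain ⟨n, c, hc, rfl⟩ := Set.mem_iUnion.mp hy
    obtain ⟨i, z, rfl⟩ | ⟨ζ, rfl⟩ := exists_hemisphere_or_infinity c
    · change hemisphere i z ∈ _ at hc
      change _^[n + 1] (hemisphere i z) ∈ _
      rw [formalMating_iterate_hemisphere]
      exact Set.mem_iUnion.mpr ⟨i, _, Set.mem_iUnion.mpr
        ⟨n, z, hemisphere_mem_criticalSet_iff.mp hc, rfl⟩, rfl⟩
    · exact absurd hc (infinity_notMem_criticalSet hf ζ)
  · intro hy
    obtain ⟨i, z, hz, rfl⟩ := Set.mem_iUnion.mp hy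
    obtain ⟨n, c, hc, rfl⟩ := Set.mem_iUnion.mp hz
    exact Set.mem_iUnion.mpr ⟨n, _, hemisphere_mem_criticalSet_iff.mpr hc,
      formalMating_iterate_hemisphere d f i (n + 1) c⟩

theorem hemisphere_mem_iUnion_image_iff {P : Bool → Set ℂ} {i : Bool} {z : ℂ} :
    hemisphere i z ∈ ⋃ i, hemisphere i '' P i ↔ z ∈ P i := by
  refine ⟨fun h => ?_, fun h => Set.mem_iUnion.mpr ⟨i, z, h, rfl⟩⟩
  obtain ⟨k, w, hw, h⟩ := Set.mem_iUnion.mp h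
  obtain ⟨rfl, rfl⟩ := hemisphere_eq_iff.mp h
  exact hw

theorem infinity_notMem_iUnion_image {P : Bool → Set ℂ} {i : Bool} {ζ : Circle} :
    side i (infinity ζ) ∉ ⋃ i, hemisphere i '' P i := by
  intro h
  obtain ⟨k, w, -, h⟩ := Set.mem_iUnion.mp h
  exact hemisphere_ne_infinity h

theorem ClosedPlane.denseRange_point : DenseRange point := by
  intro c
  have h1 : toDisk c ∈ closure (Metric.ball (0 : ℂ) 1) := by
    rw [closure_ball _ one_ne_zero]
    simpa using norm_toDisk_le c
  have h2 := image_closure_subset_closure_image continuous_ofDisk ⟨_, h1, ofDisk_toDisk c⟩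
  refine closure_mono ?_ h2
  rintro _ ⟨x, hx, rfl⟩
  exact ⟨_, (ofDisk_of_norm_lt (by simpa using hx)).symm⟩

/-- The mating sphere without finitely many points of the open hemispheres is path connected. -/
theorem MatingSphere.isPathConnected_compl {P : Bool → Set ℂ} (hP : ∀ i, (P i).Finite) :
    IsPathConnected (⋃ i, hemisphere i '' P i)ᶜ := by
  have hopen : IsOpen (⋃ i, hemisphere i '' P i)ᶜ :=
    (isClosed_iUnion_of_finite fun i => ((hP i).image _).isClosed).isOpen_compl
  rw [← hopen.isConnected_iff_isPathConnected]
  have hside : ∀ i, IsConnected (side i '' (point '' P i)ᶜ) := by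
    intro i
    refine IsConnected.image ?_ _ (continuous_side i).continuousOn
    have h1 : IsConnected (point '' (P i)ᶜ) :=
      (isPathConnected_compl_of_finite (hP i)).isConnected.image _ continuous_point.continuousOn
    -- Adding the circle at infinity keeps connectedness, because the punctured open plane is dense.
    refine h1.subset_closure ?_ fun c _ => ?_
    · rw [Set.image_subset_iff]
      rintro z hz ⟨w, hw, h⟩
      exact hz (point_injective h ▸ hw)
    · exact denseRange_point.dense_image continuous_point
        ((hP i).countable.dense_compl ℝ) c
  have hunion : (⋃ i, hemisphere i '' P i)ᶜ =
      side false '' (point '' P false)ᶜ ∪ side true '' (point '' P true)ᶜ := by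
    have key : ∀ i, side i '' (point '' P i)ᶜ ⊆ (⋃ i, hemisphere i '' P i)ᶜ := by
      rintro i _ ⟨z | ζ, hc, rfl⟩ h
      · exact hc ⟨z, hemisphere_mem_iUnion_image_iff.mp h, rfl⟩
      · exact infinity_notMem_iUnion_image h
    refine Set.Subset.antisymm (fun y hy => ?_) (Set.union_subset (key _) (key _))
    obtain ⟨i, c, rfl⟩ := exists_side y
    have hc : c ∉ point '' P i := by
      rintro ⟨z, hz, rfl⟩
      exact hy (Set.mem_iUnion.mpr ⟨i, z, hz, rfl⟩)
    cases i with
    | false => exact .inl ⟨c, hc, rfl⟩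
    | true => exact .inr ⟨c, hc, rfl⟩
  rw [hunion]
  refine (hside false).union ⟨side false (infinity 1), ⟨_, ?_, rfl⟩, ?_⟩ (hside true)
  · rintro ⟨z, -, h⟩
    cases h
  · rw [side_infinity]
    refine ⟨_, ?_, rfl⟩
    rintro ⟨z, -, h⟩
    cases h

/-- A fiber over an open hemisphere is a fiber of the corresponding plane map; a fiber over the
equator consists of `d`-th roots. -/
theorem ncard_preimage_formalMating {d : ℕ} (hd : d ≠ 0) {f : Bool → ℂ → ℂ}
    (hf : ∀ i, ∀ y ∉ postcriticalSet (f i), (f i ⁻¹' {y}).ncard = d) {y : MatingSphere}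
    (hy : y ∉ ⋃ i, hemisphere i '' postcriticalSet (f i)) :
    (formalMating d (f false) (f true) ⁻¹' {y}).ncard = d := by
  obtain ⟨i, z, rfl⟩ | ⟨ζ, rfl⟩ := exists_hemisphere_or_infinity y
  · change hemisphere i z ∉ _ at hy
    rw [hemisphere_mem_iUnion_image_iff] at hy
    refine Eq.trans ?_ ((Set.ncard_image_of_injective _
      (isOpenEmbedding_hemisphere i).injective).trans (hf i z hy))
    congr 1
    ext y
    constructor
    · intro h
      obtain ⟨w, rfl, hw⟩ := formalMating_eq_hemisphere (i := i) h
      exact ⟨w, hw, rfl⟩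
    · rintro ⟨w, hw, rfl⟩
      exact (formalMating_hemisphere d f i w).trans (congrArg _ hw)
  · have hinj : Function.Injective fun ξ : Circle => side false (infinity ξ) := by
      intro ξ ξ' h
      have := side_injective _ h
      injection this
    refine Eq.trans ?_ ((Set.ncard_image_of_injective _ hinj).trans (Circle.ncard_pow_eq hd ζ))
    congr 1
    ext y
    constructor
    · intro h
      obtain ⟨i, z, rfl⟩ | ⟨ξ, rfl⟩ := exists_hemisphere_or_infinity y
      · exact absurd ((formalMating_hemisphere d f i z).symm.trans h) hemisphere_ne_infinity
      · exact ⟨ξ, hinj ((formalMating_infinity d f false ξ).symm.trans h), rfl⟩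
    · rintro ⟨ξ, hξ, rfl⟩
      refine (formalMating_infinity d f false ξ).trans ?_
      rw [show ξ ^ d = ζ from hξ]

/-! ### Path classes and generation of the fundamental group -/

namespace Path.Homotopic.Quotient

variable {X : Type*} [TopologicalSpace X] {x y z : X}

theorem symm_trans_trans (p : Path.Homotopic.Quotient x y) (q : Path.Homotopic.Quotient y z) :
    p.symm.trans (p.trans q) = q := by
  rw [← trans_assoc, symm_trans, refl_trans]

theorem trans_symm_trans (p : Path.Homotopic.Quotient x y) (q : Path.Homotopic.Quotient x z) :
    p.trans (p.symm.trans q) = q := by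
  rw [← trans_assoc, trans_symm, refl_trans]

theorem symm_trans_rev (p : Path.Homotopic.Quotient x y) (q : Path.Homotopic.Quotient y z) :
    (p.trans q).symm = q.symm.trans p.symm := by
  induction p using Quotient.ind with | mk p =>
  induction q using Quotient.ind with | mk q =>
  rw [← mk_trans, ← mk_symm, Path.trans_symm]
  rfl

theorem map_trans {Y : Type*} [TopologicalSpace Y] (p : Path.Homotopic.Quotient x y)
    (q : Path.Homotopic.Quotient y z) (f : C(X, Y)) :
    (p.trans q).map f = (p.map f).trans (q.map f) := by
  induction p using Quotient.ind with | mk p =>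
  induction q using Quotient.ind with | mk q =>
  rw [← mk_trans, ← mk_map, Path.map_trans]
  rfl

theorem map_symm {Y : Type*} [TopologicalSpace Y] (p : Path.Homotopic.Quotient x y) (f : C(X, Y)) :
    p.symm.map f = (p.map f).symm := by
  induction p using Quotient.ind with | mk p => rfl

end Path.Homotopic.Quotient

open Path.Homotopic.Quotient in
/-- The loops in two path connected open sets with path connected intersection generate the
fundamental group of their union. -/
theorem FundamentalGroup.subgroup_eq_top_of_isOpen_cover {X : Type*} [TopologicalSpace X]
    {W : Bool → Set X} (hWo : ∀ i, IsOpen (W i)) (hcov : ∀ x, ∃ i, x ∈ W i)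
    (hW : ∀ i, IsPathConnected (W i)) (hWW : IsPathConnected (W false ∩ W true)) {t e : X}
    (he : ∀ i, e ∈ W i) (b : Path.Homotopic.Quotient t e) (K : Subgroup (FundamentalGroup X t))
    (hK : ∀ i (γ : Path e e), Set.range γ ⊆ W i →
      FundamentalGroup.fromPath (b.trans ((mk γ).trans b.symm)) ∈ K) : K = ⊤ := by
  -- Multiplication in `FundamentalGroup` is concatenation in reverse order, whence the swapped
  -- arguments.
  have hmul : ∀ p q : Path.Homotopic.Quotient t t, FundamentalGroup.fromPath p ∈ K →
      FundamentalGroup.fromPath q ∈ K → FundamentalGroup.fromPath (p.trans q) ∈ K :=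
    fun p q hp hq => K.mul_mem hq hp
  -- The invariant carried along a path: closing `q` up through any path from `e` to `y` inside any
  -- one of the open sets gives an element of `K`. Quantifying over all such return paths allows a
  -- change of open set at `y`.
  let good : ∀ y, Path.Homotopic.Quotient t y → Prop := fun y q =>
    ∀ i (c : Path e y), Set.range c ⊆ W i →
      FundamentalGroup.fromPath (q.trans ((mk c).symm.trans b.symm)) ∈ K
  have joined : ∀ {A : Set X}, IsPathConnected A → ∀ {x y}, x ∈ A → y ∈ A →
      ∃ c : Path x y, Set.range c ⊆ A := fun hA x y hx hy => by
    obtain ⟨c, hc⟩ := hA.joinedIn x hx y hy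
    exact ⟨c, Set.range_subset_iff.mpr hc⟩
  have step : ∀ {y z} (σ : Path y z) i, Set.range σ ⊆ W i → ∀ q, good y q →
      good z (q.trans (mk σ)) := by
    intro y z σ i hσ q hq k c hc
    have hy : y ∈ W i := hσ ⟨0, σ.source⟩
    have hz : z ∈ W i := hσ ⟨1, σ.target⟩
    obtain ⟨a, ha⟩ := joined (hW i) (he i) hy
    have key : ∀ c' : Path e z, Set.range c' ⊆ W i →
        FundamentalGroup.fromPath ((q.trans (mk σ)).trans ((mk c').symm.trans b.symm)) ∈ K := by
      intro c' hc'
      have h1 := hq i a ha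
      have h2 := hK i ((a.trans σ).trans c'.symm) (by
        rw [Path.trans_range, Path.trans_range, Path.symm_range]
        exact Set.union_subset (Set.union_subset ha hσ) hc')
      have h3 := hmul _ _ h1 h2
      simpa only [mk_trans, mk_symm, trans_assoc, symm_trans_trans] using h3
    by_cases hik : k = i
    · subst hik
      exact key c hc
    -- When the return path is in the other open set, a detour `c'` in the intersection counts as a
    -- path in both: `step` for `W i` handles `c'`, and the loop `c' · c⁻¹` lies in `W k`.
    · have hz' : z ∈ W false ∩ W true := by
        have hzk : z ∈ W k := hc ⟨1, c.target⟩
        cases i <;> cases k <;> first | exact absurd rfl hik | exact ⟨‹_›, ‹_›⟩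
      obtain ⟨c', hc'⟩ := joined hWW ⟨he false, he true⟩ hz'
      have hc'' : ∀ i, Set.range c' ⊆ W i := fun i => by
        cases i
        exacts [hc'.trans Set.inter_subset_left, hc'.trans Set.inter_subset_right]
      have h1 := key c' (hc'' i)
      have h2 := hK k (c'.trans c.symm) (by
        rw [Path.trans_range, Path.symm_range]
        exact Set.union_subset (hc'' k) hc)
      have h3 := hmul _ _ h1 h2
      simpa only [mk_trans, mk_symm, trans_assoc, symm_trans_trans] using h3
  have main : ∀ {y z} (γ : Path y z) q, good y q → good z (q.trans (mk γ)) := by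
    intro y z γ
    -- A Lebesgue subdivision: each piece of `γ` lies in a single `W i`.
    obtain ⟨s, hs0, hsm, ⟨n, hn⟩, hsW⟩ := exists_monotone_Icc_subset_open_cover_unitInterval
      (c := fun i => γ ⁻¹' W i) (fun i => (hWo i).preimage γ.continuous) fun u _ =>
        Set.mem_iUnion.mpr (hcov (γ u))
    have ind : ∀ n q, good (γ 0) q → good (γ (s n)) (q.trans (mk (γ.subpath 0 (s n)))) := by
      intro n
      induction n with
      | zero =>
        intro q hq
        rw [hs0, Path.subpath_self, mk_refl, trans_refl]
        exact hq
      | succ n ih =>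
        intro q hq
        obtain ⟨i, hi⟩ := hsW n
        have h1 := step (γ.subpath (s n) (s (n + 1))) i (by
          rw [Path.range_subpath_of_le _ _ _ (hsm n.le_succ)]
          exact Set.image_subset_iff.mpr hi) _ (ih q hq)
        rw [trans_assoc, ← mk_trans,
          Path.Homotopic.Quotient.eq.mpr
            ⟨Path.Homotopy.subpathTransSubpath γ 0 (s n) (s (n + 1))⟩] at h1
        exact h1
    have h1 := ind n
    rw [hn n le_rfl, Path.subpath_zero_one] at h1
    have cast : ∀ {y' z'} (hy : y' = y) (hz : z' = z),
        (∀ q, good y' q → good z' (q.trans (mk (γ.cast hy hz)))) →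
        ∀ q, good y q → good z (q.trans (mk γ)) := by
      rintro _ _ rfl rfl h
      exact h
    exact cast _ _ h1
  have hb : good e b := fun i c hc => by
    have := hK i c.symm (by rwa [Path.symm_range])
    rwa [mk_symm] at this
  refine eq_top_iff.mpr fun γ _ => ?_
  induction γ using Path.Homotopic.Quotient.ind with | mk γ =>
  induction b using Path.Homotopic.Quotient.ind with | mk b =>
  -- Transporting `b` along the conjugated loop at `e` and returning by the constant path recovers
  -- `γ`.
  have h1 := main ((b.symm.trans γ).trans b) _ hb false (Path.refl e) (by
    rintro _ ⟨u, rfl⟩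
    exact he false)
  have h2 : mk γ = ((mk b).trans (mk ((b.symm.trans γ).trans b))).trans
      ((mk (Path.refl e)).symm.trans (mk b).symm) := by
    have h3 : (mk (Path.refl e)).symm = Path.Homotopic.Quotient.refl e := by
      rw [← mk_symm, Path.refl_symm, mk_refl]
    simp only [mk_trans, mk_symm, trans_assoc, trans_symm_trans, refl_trans, h3, trans_symm,
      trans_refl]
  rw [← h2] at h1
  exact h1

open Path.Homotopic.Quotient in
/-- The homomorphism of fundamental groups `γ ↦ b · ι(γ) · b⁻¹` induced by a continuous map `ι`
and a path `b`. -/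
noncomputable def FundamentalGroup.mapAlong {X Y : Type*} [TopologicalSpace X] [TopologicalSpace Y]
    (ι : C(Y, X)) {t : X} {s : Y} (b : Path.Homotopic.Quotient t (ι s)) :
    FundamentalGroup Y s →* FundamentalGroup X t where
  toFun γ := b.trans ((Path.Homotopic.Quotient.map γ ι).trans b.symm)
  map_one' := by
    change b.trans ((Path.Homotopic.Quotient.map (.refl s) ι).trans b.symm) = .refl t
    have : Path.Homotopic.Quotient.map (.refl s) ι = .refl (ι s) := rfl
    rw [this, refl_trans, trans_symm]
  map_mul' γ γ' := by
    change b.trans ((Path.Homotopic.Quotient.map (.trans γ' γ) ι).trans b.symm) =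
      (b.trans ((Path.Homotopic.Quotient.map γ' ι).trans b.symm)).trans
        (b.trans ((Path.Homotopic.Quotient.map γ ι).trans b.symm))
    simp only [map_trans, trans_assoc, symm_trans_trans]

theorem FundamentalGroup.mapAlong_fromPath {X Y : Type*} [TopologicalSpace X] [TopologicalSpace Y]
    (ι : C(Y, X)) {t : X} {s : Y} (b : Path.Homotopic.Quotient t (ι s))
    (γ : Path.Homotopic.Quotient s s) :
    FundamentalGroup.mapAlong ι b (FundamentalGroup.fromPath γ) =
      FundamentalGroup.fromPath (b.trans ((γ.map ι).trans b.symm)) := rfl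

/-! ### Comparison of monodromy actions -/

/-- The image under `κ` of the lift of `γ` is a lift of its image under `ι`, so uniqueness of lifts
matches the endpoints. -/
theorem IsCoveringMap.monodromy_map_of_semiconj {E B E' B' : Type*} [TopologicalSpace E]
    [TopologicalSpace B] [TopologicalSpace E'] [TopologicalSpace B'] {q : E → B} {q' : E' → B'}
    (hq : IsCoveringMap q) (hq' : IsCoveringMap q') (ι : C(B, B')) (κ : C(E, E'))
    (h : ∀ e, q' (κ e) = ι (q e)) {x y : B} (γ : Path.Homotopic.Quotient x y) (e : q ⁻¹' {x}) :
    (hq'.monodromy (γ.map ι) ⟨κ e, (h e).trans (congrArg ι e.2)⟩ : E') = κ (hq.monodromy γ e) := by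
  have hcast : ∀ {a b a' b' : B} (γ : Path.Homotopic.Quotient a b) (ha : a' = a) (hb : b' = b)
      {u v : B'} (hu : u = ι a') (hv : v = ι b') (hu' : u = ι a) (hv' : v = ι b),
      ((γ.cast ha hb).map ι).cast hu hv = (γ.map ι).cast hu' hv' := by
    rintro a b a' b' ⟨γ⟩ rfl rfl u v hu hv hu' hv'
    rfl
  have key : hq'.monodromy (γ.map ι) ⟨κ e, (h e).trans (congrArg ι e.2)⟩ =
      ⟨κ (hq.monodromy γ e), (h _).trans (congrArg ι (hq.monodromy γ e).2)⟩ := by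
    refine hq'.monodromy_eq_of_map_eq ((hq.liftPathQuotient γ e).map κ) ?_
    have h1 := hq.map_liftPathQuotient γ e
    have h2 : ((hq.liftPathQuotient γ e).map κ).map ⟨q', hq'.continuous⟩ =
        (((hq.liftPathQuotient γ e).map ⟨q, hq.continuous⟩).map ι).cast (h _) (h _) := by
      induction hq.liftPathQuotient γ e using Path.Homotopic.Quotient.ind with | mk Γ =>
      refine congrArg Path.Homotopic.Quotient.mk ?_
      ext u
      exact h (Γ u)
    rw [h2, h1]
    exact hcast γ _ _ _ _ _ _
  rw [key]

namespace IsPartialSelfCovering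

theorem mem_ker_monodromyAction_iff {X : Type*} [TopologicalSpace X] {f : X → X} {M : Set X}
    {d : ℕ} (h : IsPartialSelfCovering f M d) {t : M} {γ : FundamentalGroup M t} :
    γ ∈ (h.monodromyAction t).ker ↔ ∀ n x, (h.iterate n).monodromy γ x = x := by
  rw [MonoidHom.mem_ker]
  constructor
  · intro hγ n x
    have := Equiv.congr_fun hγ ⟨n, x⟩
    exact eq_of_heq (Sigma.mk.inj this).2
  · intro hγ
    exact Equiv.ext fun ⟨n, x⟩ => congrArg (Sigma.mk n) (hγ n x)

/-- The monodromy action of a subsystem is the restriction of the monodromy action. -/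
theorem mapAlong_mem_ker_iff {X Y : Type*} [TopologicalSpace X] [TopologicalSpace Y] {f : X → X}
    {M : Set X} {d : ℕ} (h : IsPartialSelfCovering f M d) {g : Y → Y} {N : Set Y} {d' : ℕ}
    (h' : IsPartialSelfCovering g N d') {j : Y → X} (hj : Continuous j)
    (hinj : Function.Injective j) (hfj : ∀ n y, f^[n] (j y) = j (g^[n] y))
    (hpre : ∀ n x y, f^[n] x = j y → ∃ z, x = j z ∧ g^[n] z = y) (hNM : ∀ y ∈ N, j y ∈ M)
    {t : M} {s : N} (ι : C(N, M)) (hι : ∀ y, (ι y : X) = j y)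
    (b : Path.Homotopic.Quotient t (ι s)) {γ : FundamentalGroup N s} :
    FundamentalGroup.mapAlong ι b γ ∈ (h.monodromyAction t).ker ↔
      γ ∈ (h'.monodromyAction s).ker := by
  rw [mem_ker_monodromyAction_iff, mem_ker_monodromyAction_iff]
  refine forall_congr' fun n => ?_
  have hjM : ∀ y : g^[n] ⁻¹' N, j y ∈ f^[n] ⁻¹' M := fun y => by
    rw [Set.mem_preimage, hfj]
    exact hNM _ y.2
  let κ : C(g^[n] ⁻¹' N, f^[n] ⁻¹' M) :=
    ⟨fun y => ⟨j y, hjM y⟩, (hj.comp continuous_subtype_val).subtype_mk hjM⟩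
  have hκ : ∀ e, M.restrictPreimage f^[n] (κ e) = ι (N.restrictPreimage g^[n] e) := fun e =>
    Subtype.ext ((hfj n e.1).trans (hι (N.restrictPreimage g^[n] e)).symm)
  have hκinj : Function.Injective κ := fun e e' hee => Subtype.ext (hinj (congrArg Subtype.val hee))
  have hmap := fun e => (h'.iterate n).monodromy_map_of_semiconj (h.iterate n) ι κ hκ γ e
  -- Transport along `b` is a bijection between fibers, and conjugating by it does not affect acting
  -- trivially.
  have h1 : (∀ x, (h.iterate n).monodromy (FundamentalGroup.mapAlong ι b γ) x = x) ↔
      ∀ x, (h.iterate n).monodromy (Path.Homotopic.Quotient.map γ ι) x = x := by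
    have hb := (h.iterate n).monodromy_bijective b
    change (∀ x, (h.iterate n).monodromy
      (b.trans ((Path.Homotopic.Quotient.map γ ι).trans b.symm)) x = x) ↔ _
    refine Iff.trans ?_ (hb.2.forall (p := fun x =>
      (h.iterate n).monodromy (Path.Homotopic.Quotient.map γ ι) x = x)).symm
    refine forall_congr' fun x => ?_
    have hbs : ∀ x, (h.iterate n).monodromy b ((h.iterate n).monodromy b.symm x) = x := fun x => by
      rw [← IsCoveringMap.monodromy_trans_apply, Path.Homotopic.Quotient.symm_trans,
        IsCoveringMap.monodromy_refl, id]
    rw [IsCoveringMap.monodromy_trans_apply, IsCoveringMap.monodromy_trans_apply,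
      ← hb.1.eq_iff, hbs]
  rw [h1]
  constructor
  · intro hγ e
    have h2 := hmap e
    rw [hγ] at h2
    exact Subtype.ext (hκinj h2.symm)
  · rintro hγ ⟨x, hx⟩
    have hx' : f^[n] x = j s := (congrArg Subtype.val hx).trans (hι s)
    -- Backward invariance puts the entire fiber in the image of `j`; without it, `γ` could act
    -- trivially on the subsystem but not on the rest of the fiber.
    obtain ⟨z, hz, hzs⟩ := hpre n _ _ hx'
    have hzN : g^[n] z ∈ N := hzs ▸ s.2
    have h2 := hmap ⟨⟨z, hzN⟩, Subtype.ext hzs⟩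
    rw [hγ] at h2
    have hx2 : x = κ ⟨z, hzN⟩ := Subtype.ext hz
    subst hx2
    exact Subtype.ext h2

end IsPartialSelfCovering

/-! ### Images of subgroups in a quotient -/

/-- The image of `φ : A →* B` in `B ⧸ K` is isomorphic to the quotient by the preimage of `K`. -/
theorem nonempty_range_mk_comp_mulEquiv {A B : Type*} [Group A] [Group B] (K : Subgroup B)
    [K.Normal] (L : Subgroup A) [L.Normal] (φ : A →* B) (h : ∀ a, φ a ∈ K ↔ a ∈ L) :
    Nonempty (((QuotientGroup.mk' K).comp φ).range ≃* A ⧸ L) := by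
  have hL : L = ((QuotientGroup.mk' K).comp φ).ker := by
    ext a
    rw [MonoidHom.mem_ker, MonoidHom.comp_apply, QuotientGroup.mk'_apply,
      QuotientGroup.eq_one_iff, h]
  exact ⟨((QuotientGroup.quotientMulEquivOfEq hL).trans
    (QuotientGroup.quotientKerEquivRange _)).symm⟩

theorem range_mk_comp_sup_range_mk_comp {A₁ A₂ B : Type*} [Group A₁] [Group A₂] [Group B]
    (K : Subgroup B) [K.Normal] (φ₁ : A₁ →* B) (φ₂ : A₂ →* B) (h : φ₁.range ⊔ φ₂.range = ⊤) :
    ((QuotientGroup.mk' K).comp φ₁).range ⊔ ((QuotientGroup.mk' K).comp φ₂).range = ⊤ := by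
  rw [MonoidHom.range_comp, MonoidHom.range_comp, ← Subgroup.map_sup, h,
    ← MonoidHom.range_eq_map, MonoidHom.range_eq_top]
  exact QuotientGroup.mk'_surjective K

open ClosedPlane

/-! ### Planar charts of the sphere and the radial push -/

namespace MatingSphere

/-- The chart of the mating sphere without the center of the hemisphere `!i`: the closed unit disk
is mapped to the hemisphere `i`, its complement to the hemisphere `!i`. -/
noncomputable def planeChart (i : Bool) (z : ℂ) : MatingSphere :=
  if ‖z‖ ≤ 1 then side i (ofDisk z)
    else side (!i) (ofDisk ((starRingEnd ℂ) z / ((max ‖z‖ 1 ^ 2 : ℝ) : ℂ)))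

theorem planeChart_of_le (i : Bool) {z : ℂ} (h : ‖z‖ ≤ 1) : planeChart i z = side i (ofDisk z) :=
  if_pos h

theorem ofDisk_of_norm_eq_one {z : ℂ} (h : ‖z‖ = 1) :
    ∃ ζ : Circle, (ζ : ℂ) = z ∧ ofDisk z = infinity ζ :=
  ⟨⟨z, mem_sphere_zero_iff_norm.mpr h⟩, rfl,
    ofDisk_eq_infinity ⟨z, mem_sphere_zero_iff_norm.mpr h⟩⟩

theorem side_ofDisk_of_norm_eq_one (i : Bool) {z : ℂ} (h : ‖z‖ = 1) :
    side i (ofDisk z) = side (!i) (ofDisk ((starRingEnd ℂ) z)) := by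
  obtain ⟨ζ, rfl, h⟩ := ofDisk_of_norm_eq_one h
  rw [h, side_infinity, ← Circle.coe_inv_eq_conj, ofDisk_eq_infinity]

theorem planeChart_of_ge (i : Bool) {z : ℂ} (h : 1 ≤ ‖z‖) :
    planeChart i z = side (!i) (ofDisk ((starRingEnd ℂ) z / ((‖z‖ ^ 2 : ℝ) : ℂ))) := by
  rcases h.eq_or_lt with h | h
  · rw [planeChart_of_le i h.symm.le, side_ofDisk_of_norm_eq_one i h.symm, ← h]
    simp
  · rw [planeChart, if_neg h.not_ge, max_eq_left h.le]

theorem continuous_planeChart (i : Bool) : Continuous (planeChart i) := by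
  refine Continuous.if_le ?_ ?_ continuous_norm continuous_const fun z hz => ?_
  · exact (continuous_side i).comp continuous_ofDisk
  -- This branch has to be continuous on all of `ℂ`; the `max ‖z‖ 1` in the chart keeps its
  -- denominator away from zero.
  · refine (continuous_side _).comp (continuous_ofDisk.comp ?_)
    refine Complex.continuous_conj.div (Complex.continuous_ofReal.comp (by fun_prop)) fun z => ?_
    have : 0 < max ‖z‖ 1 ^ 2 := pow_pos (lt_of_lt_of_le one_pos (le_max_right _ _)) 2
    exact_mod_cast this.ne'
  · rw [side_ofDisk_of_norm_eq_one i hz, hz]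
    simp

/-- A continuous map which is the inverse of `planeChart i` outside of the disk of radius `r` of the
hemisphere `!i`. -/
noncomputable def toPlaneChart (i : Bool) (r : ℝ) (hr : r ≤ 1) : MatingSphere → ℂ :=
  lift (fun k c => if k = i then toDisk c else
    (starRingEnd ℂ) (toDisk c) / ((max ‖toDisk c‖ r ^ 2 : ℝ) : ℂ)) (fun ζ => by
      cases i <;> simp [Circle.norm_coe, hr, Circle.coe_inv_eq_conj, -Circle.coe_inv])

theorem toPlaneChart_side_self (i : Bool) {r : ℝ} (hr : r ≤ 1) (c : ClosedPlane) :
    toPlaneChart i r hr (side i c) = toDisk c := by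
  rw [toPlaneChart, lift_side, if_pos rfl]

theorem toPlaneChart_side_not (i : Bool) {r : ℝ} (hr : r ≤ 1) (c : ClosedPlane) :
    toPlaneChart i r hr (side (!i) c) =
      (starRingEnd ℂ) (toDisk c) / ((max ‖toDisk c‖ r ^ 2 : ℝ) : ℂ) := by
  rw [toPlaneChart, lift_side, if_neg (by simp)]

theorem exists_side_self_or_not (i : Bool) (y : MatingSphere) :
    (∃ c, side i c = y) ∨ ∃ c, side (!i) c = y := by
  obtain ⟨k, c, rfl⟩ := exists_side y
  by_cases h : k = i
  · subst h
    exact .inl ⟨c, rfl⟩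
  · obtain rfl : k = !i := by cases k <;> cases i <;> simp_all
    exact .inr ⟨c, rfl⟩

theorem continuous_toPlaneChart (i : Bool) {r : ℝ} (hr0 : 0 < r) (hr : r ≤ 1) :
    Continuous (toPlaneChart i r hr) := by
  refine continuous_iff.mpr fun k => ?_
  by_cases h : k = i
  · subst h
    rw [show toPlaneChart k r hr ∘ side k = toDisk from
      funext fun c => toPlaneChart_side_self k hr c]
    exact continuous_toDisk
  · obtain rfl : k = !i := by cases k <;> cases i <;> simp_all
    rw [show toPlaneChart i r hr ∘ side (!i) = _ from funext fun c => toPlaneChart_side_not i hr c]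
    have h := continuous_toDisk
    refine (Complex.continuous_conj.comp h).div (Complex.continuous_ofReal.comp
      ((h.norm.max continuous_const).pow 2)) fun c => ?_
    have : 0 < max ‖toDisk c‖ r ^ 2 := pow_pos (lt_of_lt_of_le hr0 (le_max_right _ _)) 2
    exact_mod_cast this.ne'

theorem norm_conj_div_norm_sq {z : ℂ} (h : z ≠ 0) :
    ‖(starRingEnd ℂ) z / ((‖z‖ ^ 2 : ℝ) : ℂ)‖ = ‖z‖⁻¹ := by
  have : ‖z‖ ≠ 0 := norm_ne_zero_iff.mpr h
  rw [norm_div, RCLike.norm_conj, Complex.norm_real, Real.norm_of_nonneg (by positivity)]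
  field_simp

theorem conj_div_norm_sq_conj_div_norm_sq {z : ℂ} (h : z ≠ 0) :
    (starRingEnd ℂ) ((starRingEnd ℂ) z / ((‖z‖ ^ 2 : ℝ) : ℂ)) /
      ((‖(starRingEnd ℂ) z / ((‖z‖ ^ 2 : ℝ) : ℂ)‖ ^ 2 : ℝ) : ℂ) = z := by
  have h1 : (‖z‖ : ℂ) ≠ 0 := by exact_mod_cast norm_ne_zero_iff.mpr h
  rw [norm_conj_div_norm_sq h, map_div₀, Complex.conj_conj, Complex.conj_ofReal]
  push_cast
  field_simp

theorem planeChart_toPlaneChart (i : Bool) {r : ℝ} (hr0 : 0 < r) (hr : r ≤ 1) {y : MatingSphere}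
    (hy : y ∉ side (!i) '' {c | ‖toDisk c‖ ≤ r}) :
    planeChart i (toPlaneChart i r hr y) = y ∧ ‖toPlaneChart i r hr y‖ < r⁻¹ := by
  obtain ⟨c, rfl⟩ | ⟨c, rfl⟩ := exists_side_self_or_not i y
  · rw [toPlaneChart_side_self, planeChart_of_le i (norm_toDisk_le c), ofDisk_toDisk]
    refine ⟨rfl, ?_⟩
    rcases (norm_toDisk_le c).lt_or_eq with h | h
    · exact h.trans_le ((one_le_inv₀ hr0).mpr hr)
    · rcases hr.lt_or_eq with h' | h'
      · rw [h]
        exact (one_lt_inv₀ hr0).mpr h'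
      -- For `r = 1` the strict bound would fail on the equator, but equatorial points then belong
      -- to the excluded disk.
      · exfalso
        obtain ⟨ζ, hζ, hζ'⟩ := ofDisk_of_norm_eq_one h
        rw [ofDisk_toDisk] at hζ'
        subst hζ'
        exact hy ⟨infinity ζ⁻¹, by
          rw [h']
          exact norm_toDisk_le _, (side_infinity i ζ).symm⟩
  · have hc : r < ‖toDisk c‖ := by
      by_contra! h
      exact hy ⟨c, h, rfl⟩
    have h0 : toDisk c ≠ 0 := norm_ne_zero_iff.mp (hr0.trans hc).ne'
    rw [toPlaneChart_side_not, max_eq_left hc.le, planeChart_of_ge, conj_div_norm_sq_conj_div_norm_sq h0,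
      ofDisk_toDisk, norm_conj_div_norm_sq h0]
    · exact ⟨rfl, (inv_lt_inv₀ (hr0.trans hc) hr0).mpr hc⟩
    · rw [norm_conj_div_norm_sq h0]
      exact (one_le_inv₀ (hr0.trans hc)).mpr (norm_toDisk_le c)

/-- Outside the unit disk the chart is an inversion, giving disk coordinates of modulus `‖z‖⁻¹`. -/
theorem planeChart_mem_image_side_not_iff (i : Bool) {r : ℝ} (hr0 : 0 < r) (hr : r < 1) {z : ℂ} :
    planeChart i z ∈ side (!i) '' {c | ‖toDisk c‖ ≤ r} ↔ r⁻¹ ≤ ‖z‖ := by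
  have hpoint : ∀ {c}, ‖toDisk c‖ ≤ r → ∃ w, c = point w := fun {c} hc => by
    obtain ⟨w, rfl⟩ : c ∈ Set.range point := by
      rw [range_point]
      exact lt_of_le_of_lt hc hr
    exact ⟨w, rfl⟩
  constructor
  · rintro ⟨c, hc, h⟩
    obtain ⟨w, rfl⟩ := hpoint hc
    rcases le_total ‖z‖ 1 with hz | hz
    · rw [planeChart_of_le i hz] at h
      have := (eq_of_side_point_eq h).1
      simp at this
    · rw [planeChart_of_ge i hz] at h
      have hz0 : z ≠ 0 := norm_ne_zero_iff.mp (one_pos.trans_le hz).ne'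
      have h1 : ‖z‖⁻¹ ≤ 1 := inv_le_one_of_one_le₀ hz
      rw [side_injective _ h] at hc
      change ‖toDisk (ofDisk _)‖ ≤ r at hc
      rw [toDisk_ofDisk_of_norm_le (by rwa [norm_conj_div_norm_sq hz0]),
        norm_conj_div_norm_sq hz0] at hc
      exact (inv_le_comm₀ (one_pos.trans_le hz) hr0).mp hc
  · intro hz
    have hz1 : 1 ≤ ‖z‖ := ((one_le_inv₀ hr0).mpr hr.le).trans hz
    have hz0 : z ≠ 0 := norm_ne_zero_iff.mp (one_pos.trans_le hz1).ne'
    have h1 : ‖z‖⁻¹ ≤ 1 := inv_le_one_of_one_le₀ hz1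
    refine ⟨_, ?_, (planeChart_of_ge i hz1).symm⟩
    change ‖toDisk (ofDisk _)‖ ≤ r
    rw [toDisk_ofDisk_of_norm_le (by rwa [norm_conj_div_norm_sq hz0]), norm_conj_div_norm_sq hz0]
    exact (inv_le_comm₀ (one_pos.trans_le hz1) hr0).mpr hz

theorem planeChart_mem_image_side_self_iff (i : Bool) {r : ℝ} (hr : r < 1) {z : ℂ} :
    planeChart i z ∈ side i '' {c | ‖toDisk c‖ ≤ r} ↔ ‖z‖ ≤ r := by
  constructor
  · rintro ⟨c, hc, h⟩
    obtain ⟨w, rfl⟩ : c ∈ Set.range point := by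
      rw [range_point]
      exact lt_of_le_of_lt hc hr
    rcases le_total ‖z‖ 1 with hz | hz
    · rw [planeChart_of_le i hz] at h
      rw [side_injective _ h] at hc
      change ‖toDisk (ofDisk _)‖ ≤ r at hc
      rwa [toDisk_ofDisk_of_norm_le hz] at hc
    · rw [planeChart_of_ge i hz] at h
      have := (eq_of_side_point_eq h).1
      simp at this
  · intro hz
    refine ⟨_, ?_, (planeChart_of_le i (hz.trans hr.le)).symm⟩
    change ‖toDisk (ofDisk _)‖ ≤ r
    rwa [toDisk_ofDisk_of_norm_le (hz.trans hr.le)]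

theorem hemisphere_eq_planeChart (i : Bool) (w : ℂ) :
    hemisphere i w = planeChart i (toDisk (point w)) := by
  rw [planeChart_of_le i (norm_toDisk_le _), ofDisk_toDisk]
  rfl

theorem planeChart_eq_hemisphere_of_norm_lt (i : Bool) {z : ℂ} (h : ‖z‖ < 1) :
    planeChart i z = hemisphere i (z / (1 - ‖z‖ : ℝ)) := by
  rw [planeChart_of_le i h.le, ofDisk_of_norm_lt h]
  rfl

/-- The map `z ↦ λ z` with `0 < λ ≤ 1` which moves at time `1` the plane to the disk of
radius `m`, fixing this disk. -/
noncomputable def radialPush (m s : ℝ) (z : ℂ) : ℂ := ((1 - s + s * (m / max m ‖z‖) : ℝ) : ℂ) * z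

theorem continuous_radialPush {m : ℝ} (hm : 0 < m) :
    Continuous fun v : ℝ × ℂ => radialPush m v.1 v.2 := by
  refine (Complex.continuous_ofReal.comp ?_).mul continuous_snd
  refine (continuous_const.sub continuous_fst).add (continuous_fst.mul
    (continuous_const.div (continuous_const.max continuous_snd.norm) fun v => ?_))
  exact (lt_of_lt_of_le hm (le_max_left _ _)).ne'

theorem radialPush_zero (m : ℝ) (z : ℂ) : radialPush m 0 z = z := by simp [radialPush]

theorem radialPush_of_le {m : ℝ} (hm : 0 < m) (s : ℝ) {z : ℂ} (hz : ‖z‖ ≤ m) :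
    radialPush m s z = z := by
  rw [radialPush, max_eq_left hz, div_self hm.ne']
  simp

theorem norm_radialPush_one_le {m : ℝ} (hm : 0 < m) (z : ℂ) : ‖radialPush m 1 z‖ ≤ m := by
  have h0 : 0 < max m ‖z‖ := lt_of_lt_of_le hm (le_max_left _ _)
  rw [radialPush, norm_mul, Complex.norm_real, Real.norm_of_nonneg (by simp; positivity), sub_self,
    zero_add, one_mul, div_mul_eq_mul_div, div_le_iff₀ h0]
  exact mul_le_mul_of_nonneg_left (le_max_right _ _) hm.le

theorem norm_radialPush_mem {m : ℝ} (hm : 0 < m) {s : ℝ} (hs0 : 0 ≤ s) (hs1 : s ≤ 1) {z : ℂ}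
    (hz : m ≤ ‖z‖) : m ≤ ‖radialPush m s z‖ ∧ ‖radialPush m s z‖ ≤ ‖z‖ := by
  have h0 : 0 < ‖z‖ := hm.trans_le hz
  have h1 : 0 ≤ 1 - s + s * (m / ‖z‖) := by
    have : 0 ≤ s * (m / ‖z‖) := by positivity
    linarith
  rw [radialPush, norm_mul, Complex.norm_real, max_eq_right hz, Real.norm_of_nonneg h1]
  have h2 : (1 - s + s * (m / ‖z‖)) * ‖z‖ = (1 - s) * ‖z‖ + s * m := by field_simp
  rw [h2]
  constructor <;> nlinarith

end MatingSphere

open ClosedPlane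

/-! ### Caps and generation by the two hemispheres -/

namespace MatingSphere

/-- The complement in the mating sphere of finitely many points of the hemispheres and of a smaller
closed disk in the hemisphere `!i`. -/
def cap (P : Bool → Set ℂ) (r : ℝ) (i : Bool) : Set MatingSphere :=
  (⋃ k, hemisphere k '' P k)ᶜ ∩ (side (!i) '' {c | ‖toDisk c‖ ≤ r})ᶜ

theorem isOpen_cap {P : Bool → Set ℂ} (hP : ∀ i, (P i).Finite) (r : ℝ) (i : Bool) :
    IsOpen (cap P r i) := by
  refine IsOpen.inter ?_ ?_
  · exact (isClosed_iUnion_of_finite fun i => ((hP i).image _).isClosed).isOpen_compl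
  · refine (isClosedMap_side _ _ ?_).isOpen_compl
    exact isClosed_le continuous_toDisk.norm continuous_const

variable {P : Bool → Set ℂ} {r : ℝ}

theorem exists_mem_cap (hr : r < 1) {y : MatingSphere} (hy : y ∉ ⋃ k, hemisphere k '' P k) :
    ∃ i, y ∈ cap P r i := by
  by_contra! h
  have h1 : ∀ i, y ∈ side i '' {c | ‖toDisk c‖ ≤ r} := fun i => by
    by_contra hy'
    exact h (!i) ⟨hy, by rwa [Bool.not_not]⟩
  obtain ⟨c, hc, hcy⟩ := h1 false
  obtain ⟨c', hc', rfl⟩ := h1 true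
  obtain ⟨w, rfl⟩ : c ∈ Set.range point := by
    rw [range_point]
    exact lt_of_le_of_lt hc hr
  exact absurd (eq_of_side_point_eq hcy).1 (by simp)

theorem infinity_mem_cap (hr : r < 1) (i k : Bool) (ζ : Circle) :
    side k (infinity ζ) ∈ cap P r i := by
  refine ⟨infinity_notMem_iUnion_image, ?_⟩
  rintro ⟨c, hc, h⟩
  obtain ⟨w, rfl⟩ : c ∈ Set.range point := by
    rw [range_point]
    exact lt_of_le_of_lt hc hr
  exact hemisphere_ne_infinity h

/-- The removed disk is `r⁻¹ ≤ ‖z‖` in the chart and already contains the marked points of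
hemisphere `!i`, so only those of hemisphere `i` remain as punctures. -/
theorem planeChart_mem_cap_iff (hr0 : 0 < r) (hr : r < 1)
    (hPr : ∀ i, ∀ w ∈ P i, ‖toDisk (point w)‖ < r) {i : Bool} {z : ℂ} :
    planeChart i z ∈ cap P r i ↔ ‖z‖ < r⁻¹ ∧ z ∉ (fun w => toDisk (point w)) '' P i := by
  rw [cap, Set.mem_inter_iff, Set.mem_compl_iff, Set.mem_compl_iff,
    planeChart_mem_image_side_not_iff i hr0 hr, not_le, and_comm]
  refine and_congr_right fun hz => not_congr ⟨fun h => ?_, ?_⟩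
  · obtain ⟨k, w, hw, h⟩ := Set.mem_iUnion.mp h
    by_cases hk : k = i
    · subst hk
      refine ⟨w, hw, ?_⟩
      have h1 := hPr k w hw
      have h2 : ‖z‖ ≤ r := by
        rw [← planeChart_mem_image_side_self_iff k hr, ← h]
        exact ⟨_, h1.le, rfl⟩
      rw [planeChart_of_le k (h2.trans hr.le)] at h
      have h3 := congrArg toDisk (side_injective _ h)
      rwa [toDisk_ofDisk_of_norm_le (h2.trans hr.le)] at h3
    · obtain rfl : k = !i := by cases k <;> cases i <;> simp_all
      have h2 : r⁻¹ ≤ ‖z‖ := by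
        rw [← planeChart_mem_image_side_not_iff i hr0 hr, ← h]
        exact ⟨_, (hPr _ w hw).le, rfl⟩
      exact absurd hz h2.not_gt
  · rintro ⟨w, hw, rfl⟩
    exact Set.mem_iUnion.mpr ⟨i, w, hw, hemisphere_eq_planeChart i w⟩

theorem planeChart_toPlaneChart_of_mem_cap (hr0 : 0 < r) (hr : r < 1) {i : Bool}
    {y : MatingSphere} (hy : y ∈ cap P r i) : planeChart i (toPlaneChart i r hr.le y) = y :=
  (planeChart_toPlaneChart i hr0 hr.le hy.2).1

theorem toDisk_point_injective : Function.Injective fun w => toDisk (point w) :=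
  toDisk_injective.comp point_injective

theorem isPathConnected_cap (hP : ∀ i, (P i).Finite) (hr0 : 0 < r) (hr : r < 1)
    (hPr : ∀ i, ∀ w ∈ P i, ‖toDisk (point w)‖ < r) (i : Bool) : IsPathConnected (cap P r i) := by
  -- An injective parametrization of the disk of radius `r⁻¹` by `ℂ`, which makes the cap an image
  -- of a finitely punctured plane.
  set φ : ℂ → ℂ := fun w => (r : ℂ)⁻¹ * toDisk (point w) with hφ
  have hrc : (r : ℂ) ≠ 0 := by exact_mod_cast hr0.ne'
  have hφi : Function.Injective φ := fun a b h =>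
    toDisk_point_injective (mul_left_cancel₀ (inv_ne_zero hrc) h)
  have hφc : Continuous φ := continuous_const.mul (continuous_toDisk.comp continuous_point)
  have hcap : cap P r i =
      planeChart i '' (φ '' (φ ⁻¹' ((fun w => toDisk (point w)) '' P i))ᶜ) := by
    refine Set.Subset.antisymm (fun y hy => ?_) ?_
    · have hy' := planeChart_toPlaneChart_of_mem_cap hr0 hr hy
      rw [← hy'] at hy
      obtain ⟨h1, h2⟩ := (planeChart_mem_cap_iff hr0 hr hPr).mp hy
      refine ⟨_, ?_, hy'⟩
      have h3 : (r : ℂ) * toPlaneChart i r hr.le y ∈ {x : ℂ | ‖x‖ < 1} := by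
        change ‖(r : ℂ) * _‖ < 1
        rw [norm_mul, Complex.norm_real, Real.norm_of_nonneg hr0.le]
        calc r * ‖toPlaneChart i r hr.le y‖ < r * r⁻¹ := mul_lt_mul_of_pos_left h1 hr0
          _ = 1 := mul_inv_cancel₀ hr0.ne'
      have h4 : φ ((r : ℂ) * toPlaneChart i r hr.le y /
          (1 - ‖(r : ℂ) * toPlaneChart i r hr.le y‖ : ℝ)) = toPlaneChart i r hr.le y := by
        rw [hφ]
        simp only
        rw [← ofDisk_of_norm_lt h3, toDisk_ofDisk_of_norm_le (le_of_lt h3),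
          inv_mul_cancel_left₀ hrc]
      refine ⟨_, ?_, h4⟩
      rw [Set.mem_compl_iff, Set.mem_preimage, h4]
      exact h2
    · rintro _ ⟨_, ⟨w, hw, rfl⟩, rfl⟩
      refine (planeChart_mem_cap_iff hr0 hr hPr).mpr ⟨?_, hw⟩
      rw [hφ]
      simp only
      rw [norm_mul, norm_inv, Complex.norm_real, Real.norm_of_nonneg hr0.le]
      exact mul_lt_of_lt_one_right (by positivity) (norm_toDisk_point_lt w)
  rw [hcap]
  refine ((isPathConnected_compl_of_finite ?_).image hφc).image (continuous_planeChart i)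
  exact ((hP i).image _).preimage hφi.injOn

theorem isPathConnected_cap_inter_cap (hr0 : 0 < r) (hr : r < 1)
    (hPr : ∀ i, ∀ w ∈ P i, ‖toDisk (point w)‖ < r) :
    IsPathConnected (cap P r false ∩ cap P r true) := by
  -- All punctures have modulus below `r` in their own hemisphere, so the intersection is the full
  -- annulus `r < ‖z‖ < r⁻¹`, the image under `exp` of a convex vertical strip.
  have hinter : cap P r false ∩ cap P r true =
      (fun z => planeChart false (Complex.exp z)) ''
        (Complex.reLm ⁻¹' Set.Ioo (Real.log r) (Real.log r⁻¹)) := by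
    refine Set.Subset.antisymm (fun y hy => ?_) ?_
    · have hy' := planeChart_toPlaneChart_of_mem_cap hr0 hr hy.1
      rw [← hy'] at hy
      obtain ⟨h1, h2⟩ := (planeChart_mem_cap_iff hr0 hr hPr).mp hy.1
      have h3 : r < ‖toPlaneChart false r hr.le y‖ := by
        by_contra! h
        exact hy.2.2 ((planeChart_mem_image_side_self_iff false hr).mpr h)
      have h0 : 0 < ‖toPlaneChart false r hr.le y‖ := hr0.trans h3
      refine ⟨Complex.log (toPlaneChart false r hr.le y), ?_, ?_⟩
      · change (Complex.log _).re ∈ Set.Ioo _ _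
        rw [Complex.log_re]
        exact ⟨Real.log_lt_log hr0 h3, Real.log_lt_log h0 h1⟩
      · simp only
        rw [Complex.exp_log (norm_pos_iff.mp h0), hy']
    · rintro _ ⟨z, ⟨hz1, hz2⟩, rfl⟩
      change Real.log r < z.re at hz1
      change z.re < Real.log r⁻¹ at hz2
      rw [Real.log_lt_iff_lt_exp hr0] at hz1
      rw [Real.lt_log_iff_exp_lt (inv_pos.mpr hr0)] at hz2
      rw [← Complex.norm_exp] at hz1 hz2
      have h1 : planeChart false (Complex.exp z) ∈ cap P r false := by
        refine (planeChart_mem_cap_iff hr0 hr hPr).mpr ⟨hz2, ?_⟩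
        rintro ⟨w, hw, h⟩
        simp only at h
        rw [← h] at hz1
        exact absurd (hPr _ w hw) hz1.not_gt
      refine ⟨h1, h1.1, fun h => ?_⟩
      exact absurd ((planeChart_mem_image_side_self_iff false hr).mp h) hz1.not_ge
  rw [hinter]
  refine IsPathConnected.image (Convex.isPathConnected ?_ ?_)
    ((continuous_planeChart false).comp Complex.continuous_exp)
  · exact (convex_Ioo _ _).linear_preimage Complex.reLm
  · refine ⟨0, ?_⟩
    change (0 : ℂ).re ∈ Set.Ioo _ _
    rw [Complex.zero_re]
    exact ⟨Real.log_neg hr0 hr, Real.log_pos ((one_lt_inv₀ hr0).mpr hr)⟩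

theorem radialPush_notMem {i : Bool} (hPr : ∀ i, ∀ w ∈ P i, ‖toDisk (point w)‖ < r) {m : ℝ}
    (hm0 : 0 < m) (hm : r ≤ m) {s : ℝ} (hs0 : 0 ≤ s) (hs1 : s ≤ 1) {z : ℂ}
    (hz : z ∉ (fun w => toDisk (point w)) '' P i) :
    radialPush m s z ∉ (fun w => toDisk (point w)) '' P i := by
  rcases le_total ‖z‖ m with h | h
  · rwa [radialPush_of_le hm0 s h]
  · rintro ⟨w, hw, h'⟩
    have h1 := (norm_radialPush_mem hm0 hs0 hs1 h).1
    rw [← h'] at h1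
    exact absurd (hPr i w hw) (hm.trans h1).not_gt

theorem planeChart_radialPush_mem_cap (hr0 : 0 < r) (hr : r < 1)
    (hPr : ∀ i, ∀ w ∈ P i, ‖toDisk (point w)‖ < r) {m : ℝ} (hm : r ≤ m) {s : ℝ} (hs0 : 0 ≤ s)
    (hs1 : s ≤ 1) {i : Bool} {y : MatingSphere} (hy : y ∈ cap P r i) :
    planeChart i (radialPush m s (toPlaneChart i r hr.le y)) ∈ cap P r i := by
  have hm0 := hr0.trans_le hm
  rw [← planeChart_toPlaneChart_of_mem_cap hr0 hr hy] at hy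
  obtain ⟨h1, h2⟩ := (planeChart_mem_cap_iff hr0 hr hPr).mp hy
  refine (planeChart_mem_cap_iff hr0 hr hPr).mpr
    ⟨?_, radialPush_notMem hPr hm0 hm hs0 hs1 h2⟩
  rcases le_total ‖toPlaneChart i r hr.le y‖ m with h | h
  · rwa [radialPush_of_le hm0 s h]
  · exact (norm_radialPush_mem hm0 hs0 hs1 h).2.trans_lt h1

/-- The mating sphere without the points `P i` of the hemispheres. -/
abbrev puncturedSphere (P : Bool → Set ℂ) : Set MatingSphere := (⋃ k, hemisphere k '' P k)ᶜ

/-- The inclusion of a punctured open hemisphere into the punctured mating sphere. -/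
noncomputable def puncturedHemisphere (P : Bool → Set ℂ) (i : Bool) :
    C(((P i)ᶜ : Set ℂ), (puncturedSphere P)) where
  toFun z := ⟨hemisphere i z, fun h => z.2 (hemisphere_mem_iUnion_image_iff.mp h)⟩
  continuous_toFun := ((continuous_hemisphere i).comp continuous_subtype_val).subtype_mk _

/-- A cap can be pushed into the punctured open hemisphere which it contains. -/
theorem exists_homotopy_cap (hr0 : 0 < r) (hr : r < 1)
    (hPr : ∀ i, ∀ w ∈ P i, ‖toDisk (point w)‖ < r) (i : Bool) :
    ∃ κ : C((Subtype.val ⁻¹' cap P r i : Set (puncturedSphere P)),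
      ((P i)ᶜ : Set ℂ)), Nonempty (ContinuousMap.Homotopy ⟨Subtype.val, continuous_subtype_val⟩
        ((puncturedHemisphere P i).comp κ)) := by
  -- With `r < m` the push fixes a disk containing all punctures; with `m < 1` it ends strictly
  -- inside the open hemisphere.
  obtain ⟨m, hrm, hm1⟩ := exists_between hr
  have hm0 := hr0.trans hrm
  have hψ := continuous_toPlaneChart i hr0 hr.le
  set w : puncturedSphere P → ℂ := fun y => radialPush m 1 (toPlaneChart i r hr.le y) with hw
  have hwc : Continuous w := (continuous_radialPush hm0).comp
    (continuous_const.prodMk (hψ.comp continuous_subtype_val))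
  have hw1 : ∀ y, ‖w y‖ < 1 := fun y => (norm_radialPush_one_le hm0 _).trans_lt hm1
  have hκ : ∀ y : puncturedSphere P, (y : MatingSphere) ∈ cap P r i → w y / (1 - ‖w y‖ : ℝ) ∈ (P i)ᶜ := by
    intro y hy h
    have h1 := planeChart_radialPush_mem_cap hr0 hr hPr hrm.le zero_le_one le_rfl hy
    rw [planeChart_eq_hemisphere_of_norm_lt i (hw1 y)] at h1
    exact h1.1 (Set.mem_iUnion.mpr ⟨i, _, h, rfl⟩)
  have hκc : Continuous fun y : puncturedSphere P => w y / ((1 - ‖w y‖ : ℝ) : ℂ) := by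
    refine hwc.div (Complex.continuous_ofReal.comp (continuous_const.sub hwc.norm)) fun y => ?_
    exact_mod_cast (sub_pos.mpr (hw1 y)).ne'
  refine ⟨⟨fun y => ⟨_, hκ y.1 y.2⟩, (hκc.comp continuous_subtype_val).subtype_mk _⟩, ⟨?_⟩⟩
  refine
    { toFun := fun v => ⟨planeChart i (radialPush m v.1 (toPlaneChart i r hr.le v.2)),
        (planeChart_radialPush_mem_cap hr0 hr hPr hrm.le v.1.2.1 v.1.2.2 v.2.2).1⟩
      continuous_toFun := ?_
      map_zero_left := fun y => Subtype.ext ?_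
      map_one_left := fun y => Subtype.ext ?_ }
  · have hc : Continuous fun v : unitInterval × (Subtype.val ⁻¹' cap P r i :
        Set (puncturedSphere P)) => ((v.1 : ℝ), toPlaneChart i r hr.le v.2) :=
      (continuous_subtype_val.comp continuous_fst).prodMk
        (hψ.comp (continuous_subtype_val.comp (continuous_subtype_val.comp continuous_snd)))
    exact ((continuous_planeChart i).comp ((continuous_radialPush hm0).comp hc)).subtype_mk _
  · change planeChart i (radialPush m 0 _) = _
    rw [radialPush_zero]
    exact planeChart_toPlaneChart_of_mem_cap hr0 hr y.2
  · exact planeChart_eq_hemisphere_of_norm_lt i (hw1 y.1)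

theorem exists_radius (hP : ∀ i, (P i).Finite) :
    ∃ r : ℝ, 0 < r ∧ r < 1 ∧ ∀ i, ∀ w ∈ P i, ‖toDisk (point w)‖ < r := by
  -- Inserting `0` ensures a maximum exists when there are no punctures, and makes `r` positive.
  have hfin : (insert 0 (⋃ i, (fun w => ‖toDisk (point w)‖) '' P i)).Finite :=
    (Set.finite_iUnion fun i => (hP i).image _).insert 0
  obtain ⟨a, ha, hle⟩ := Set.exists_max_image _ id hfin (Set.insert_nonempty _ _)
  simp only [id] at hle
  have ha1 : a < 1 := by
    rcases ha with rfl | ha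
    · exact one_pos
    · obtain ⟨i, w, -, rfl⟩ := Set.mem_iUnion.mp ha
      exact norm_toDisk_point_lt w
  obtain ⟨r, har, hr1⟩ := exists_between ha1
  refine ⟨r, (hle 0 (Set.mem_insert _ _)).trans_lt har, hr1, fun i w hw => ?_⟩
  exact (hle _ (Set.mem_insert_of_mem _ (Set.mem_iUnion.mpr ⟨i, w, hw, rfl⟩))).trans_lt har

open Path.Homotopic.Quotient in
/-- The fundamental group of the punctured mating sphere is generated by copies of the fundamental
groups of the two punctured hemispheres. -/
theorem exists_paths_generate_fundamentalGroup (hP : ∀ i, (P i).Finite)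
    (t : (puncturedSphere P)) (s : ∀ i, ((P i)ᶜ : Set ℂ)) :
    ∃ b : ∀ i, Path.Homotopic.Quotient t (puncturedHemisphere P i (s i)),
      (FundamentalGroup.mapAlong (puncturedHemisphere P false) (b false)).range ⊔
        (FundamentalGroup.mapAlong (puncturedHemisphere P true) (b true)).range = ⊤ := by
  obtain ⟨r, hr0, hr, hPr⟩ := exists_radius hP
  have hcapM : ∀ i, cap P r i ⊆ puncturedSphere P := fun i => Set.inter_subset_left
  let e : puncturedSphere P := ⟨side false (infinity 1), infinity_notMem_iUnion_image⟩
  have he : ∀ i, e ∈ (Subtype.val ⁻¹' cap P r i : Set (puncturedSphere P)) := fun i => infinity_mem_cap hr i _ _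
  choose κ H using fun i => exists_homotopy_cap hr0 hr hPr i
  have hMpath : JoinedIn (puncturedSphere P) t e := (isPathConnected_compl hP).joinedIn _ t.2 _ e.2
  let bt : Path t e := ((joinedIn_iff_joined t.2 e.2).mp hMpath).somePath
  let δ : ∀ i, Path (κ i ⟨e, he i⟩) (s i) := fun i =>
    ((joinedIn_iff_joined (κ i ⟨e, he i⟩).2 (s i).2).mp
      ((isPathConnected_compl_of_finite (hP i)).joinedIn _ (κ i ⟨e, he i⟩).2 _ (s i).2)).somePath
  let tr : ∀ i, Path e (puncturedHemisphere P i (κ i ⟨e, he i⟩)) := fun i =>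
    (H i).some.evalAt ⟨e, he i⟩
  -- From `t` to the equatorial point `e`, along the track of `e` under the push, then inside the
  -- punctured hemisphere to its base point.
  let b : ∀ i, Path.Homotopic.Quotient t (puncturedHemisphere P i (s i)) := fun i =>
    ((mk bt).trans (mk (tr i))).trans (Path.Homotopic.Quotient.map (mk (δ i))
      (puncturedHemisphere P i))
  refine ⟨b, FundamentalGroup.subgroup_eq_top_of_isOpen_cover
    (W := fun i => (Subtype.val ⁻¹' cap P r i : Set (puncturedSphere P)))
    (fun i => (isOpen_cap hP r i).preimage continuous_subtype_val)
    (fun y => exists_mem_cap hr y.2) (fun i => ?_) ?_ he (mk bt) _ fun i γ hγ => ?_⟩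
  · exact (isPathConnected_cap hP hr0 hr hPr i).preimage_coe (hcapM i)
  · exact (isPathConnected_cap_inter_cap hr0 hr hPr).preimage_coe
      (Set.inter_subset_left.trans (hcapM false))
  · let γ' : Path (⟨e, he i⟩ : (Subtype.val ⁻¹' cap P r i : Set (puncturedSphere P))) ⟨e, he i⟩ :=
      { toFun := fun u => ⟨γ u, hγ ⟨u, rfl⟩⟩
        continuous_toFun := γ.continuous.subtype_mk _
        source' := Subtype.ext γ.source
        target' := Subtype.ext γ.target }
    -- The push is a free homotopy from `γ` to a loop in the hemisphere, so the two differ by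
    -- conjugation with the track of the base point.
    have h1 := Path.Homotopic.Quotient.eq.mpr (Path.Homotopic.map_trans_evalAt (H i).some γ')
    have h2 : (mk γ).trans (mk (tr i)) = (mk (tr i)).trans
        (Path.Homotopic.Quotient.map (Path.Homotopic.Quotient.map (mk γ') (κ i))
          (puncturedHemisphere P i)) := h1
    have h3 : (mk γ).trans (mk bt).symm = (mk (tr i)).trans
        ((Path.Homotopic.Quotient.map (Path.Homotopic.Quotient.map (mk γ') (κ i))
          (puncturedHemisphere P i)).trans ((mk (tr i)).symm.trans (mk bt).symm)) := by
      rw [← trans_assoc, ← trans_assoc, ← h2, trans_assoc (mk γ), trans_symm, trans_refl]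
    have h4 : (mk bt).trans ((mk γ).trans (mk bt).symm) =
        FundamentalGroup.mapAlong (puncturedHemisphere P i) (b i)
          (FundamentalGroup.fromPath ((mk (δ i)).symm.trans
            ((Path.Homotopic.Quotient.map (mk γ') (κ i)).trans (mk (δ i))))) := by
      rw [FundamentalGroup.mapAlong_fromPath, h3]
      simp only [b, map_trans, map_symm, trans_assoc, symm_trans_rev,
        trans_symm_trans]
    have hle : (FundamentalGroup.mapAlong (puncturedHemisphere P i) (b i)).range ≤
        (FundamentalGroup.mapAlong (puncturedHemisphere P false) (b false)).range ⊔
        (FundamentalGroup.mapAlong (puncturedHemisphere P true) (b true)).range := by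
      cases i
      exacts [le_sup_left, le_sup_right]
    exact hle ⟨_, h4.symm⟩

end MatingSphere

/-! ### Assembly -/

open MatingSphere ClosedPlane in
/-- The iterated monodromy group of a formal mating is generated by copies of those of the two
maps. -/
theorem exists_subgroups_IMG_formalMating {d : ℕ} {f : Bool → ℂ → ℂ}
    (hP : ∀ i, (postcriticalSet (f i)).Finite)
    (hPF : postcriticalSet (formalMating d (f false) (f true)) =
      ⋃ i, hemisphere i '' postcriticalSet (f i))
    (hf : ∀ i, IsPartialSelfCovering (f i) (postcriticalSet (f i))ᶜ d)
    (h : IsPartialSelfCovering (formalMating d (f false) (f true))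
      (postcriticalSet (formalMating d (f false) (f true)))ᶜ d)
    (s : ∀ i, ((postcriticalSet (f i))ᶜ : Set ℂ))
    (t : ((postcriticalSet (formalMating d (f false) (f true)))ᶜ : Set MatingSphere)) :
    ∃ H₁ H₂ : Subgroup (h.IMG t), H₁ ⊔ H₂ = ⊤ ∧
      Nonempty (H₁ ≃* (hf false).IMG (s false)) ∧ Nonempty (H₂ ≃* (hf true).IMG (s true)) := by
  -- The types of `h` and `t` depend on this set, so it is made a variable before being replaced by
  -- the punctured sphere.
  generalize hF : (postcriticalSet (formalMating d (f false) (f true)))ᶜ = M at h t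
  rw [hPF] at hF
  subst hF
  obtain ⟨b, hb⟩ := exists_paths_generate_fundamentalGroup hP t s
  have key : ∀ i, ∀ γ, FundamentalGroup.mapAlong (puncturedHemisphere _ i) (b i) γ ∈
      (h.monodromyAction t).ker ↔ γ ∈ ((hf i).monodromyAction (s i)).ker := fun i γ =>
    h.mapAlong_mem_ker_iff (hf i) (continuous_hemisphere i)
      (isOpenEmbedding_hemisphere i).injective (formalMating_iterate_hemisphere d f i)
      (fun n x y hx => formalMating_iterate_eq_hemisphere hx)
      (fun y hy => fun h => hy (hemisphere_mem_iUnion_image_iff.mp h)) _ (fun _ => rfl) (b i)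
  exact ⟨_, _, range_mk_comp_sup_range_mk_comp _ _ _ hb,
    nonempty_range_mk_comp_mulEquiv _ _ _ (key false),
    nonempty_range_mk_comp_mulEquiv _ _ _ (key true)⟩

theorem mainTheorem5 (d : ℕ) (hd : 2 ≤ d) (p q : Polynomial ℂ)
    (hp : p.Monic) (hq : q.Monic) (hpd : p.natDegree = d) (hqd : q.natDegree = d)
    (f₁ f₂ : ℂ → ℂ) (hf₁ : f₁ = fun z => p.eval z) (hf₂ : f₂ = fun z => q.eval z)
    (hpcf₁ : IsPostcriticallyFinite f₁) (hpcf₂ : IsPostcriticallyFinite f₂) :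
    IsPostcriticallyFinite (formalMating d f₁ f₂) ∧
    ∃ (h₁ : IsPartialSelfCovering f₁ (postcriticalSet f₁)ᶜ d)
      (h₂ : IsPartialSelfCovering f₂ (postcriticalSet f₂)ᶜ d)
      (h : IsPartialSelfCovering (formalMating d f₁ f₂)
        (postcriticalSet (formalMating d f₁ f₂))ᶜ d),
      ∀ (t₁ : ((postcriticalSet f₁)ᶜ : Set ℂ)) (t₂ : ((postcriticalSet f₂)ᶜ : Set ℂ))
        (t : ((postcriticalSet (formalMating d f₁ f₂))ᶜ : Set MatingSphere)),
        ∃ H₁ H₂ : Subgroup (h.IMG t),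
          H₁ ⊔ H₂ = ⊤ ∧ Nonempty (H₁ ≃* h₁.IMG t₁) ∧ Nonempty (H₂ ≃* h₂.IMG t₂) := by
  let f : Bool → ℂ → ℂ := fun i => cond i f₂ f₁
  have hd0 : d ≠ 0 := by omega
  have hcov₁ : IsPartialSelfCovering f₁ (postcriticalSet f₁)ᶜ d := by
    subst hf₁
    exact isPartialSelfCovering_eval hd hpd hpcf₁
  have hcov₂ : IsPartialSelfCovering f₂ (postcriticalSet f₂)ᶜ d := by
    subst hf₂
    exact isPartialSelfCovering_eval hd hqd hpcf₂
  have hcov : ∀ i, IsPartialSelfCovering (f i) (postcriticalSet (f i))ᶜ d := by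
    rintro (_ | _)
    exacts [hcov₁, hcov₂]
  have hfin : ∀ i, (postcriticalSet (f i)).Finite := by
    rintro (_ | _)
    exacts [hpcf₁, hpcf₂]
  have hinf : ∀ i ζ, ∃ N ∈ 𝓝 (ClosedPlane.infinity ζ),
      Set.InjOn (ClosedPlane.extend d (f i)) N := by
    subst hf₁ hf₂
    rintro (_ | _) ζ
    exacts [exists_injOn_extend hp hpd hd0 ζ, exists_injOn_extend hq hqd hd0 ζ]
  have hcont : ∀ i, Continuous (ClosedPlane.extend d (f i)) := by
    subst hf₁ hf₂
    rintro (_ | _)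
    exacts [continuous_extend hp hpd hd0, continuous_extend hq hqd hd0]
  have hPF := postcriticalSet_formalMating (d := d) hinf
  have hF := continuous_formalMating hcont
  have hFfin : IsPostcriticallyFinite (formalMating d f₁ f₂) := by
    change (postcriticalSet (formalMating d (f false) (f true))).Finite
    rw [hPF]
    exact Set.finite_iUnion fun i => (hfin i).image _
  have hFcov : IsPartialSelfCovering (formalMating d f₁ f₂)
      (postcriticalSet (formalMating d f₁ f₂))ᶜ d := by
    -- Closedness is automatic here: the sphere is compact and Hausdorff.
    refine isPartialSelfCovering_compl_postcriticalSet hF hF.isClosedMap hFfin ?_ hd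
      fun y hy => ?_
    · rw [hPF]
      exact MatingSphere.isPathConnected_compl hfin
    · change y ∉ postcriticalSet (formalMating d (f false) (f true)) at hy
      rw [hPF] at hy
      exact ncard_preimage_formalMating hd0
        (fun i z hz => (hcov i).degree_eq z hz) hy
  refine ⟨hFfin, hcov₁, hcov₂, hFcov, fun t₁ t₂ t => ?_⟩
  exact exists_subgroups_IMG_formalMating hfin hPF hcov hFcov
    (fun i => match i with
      | false => t₁
      | true => t₂) t
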